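/- A polygon is a self-avoiding polygon on the square lattice $\mathbb Z^2$, considered up to translation, and MBR denotes its minimum bounding rectangle. For $m\ge 1$, a polygon is $m$-unimodal if its perimeter exceeds the perimeter of its MBR by exactly $2m$ and it passes through the bottom-left corner of its MBR; it is $m$-staircase if it moreover passes through the top-right corner. Traverse the polygon clockwise from the bottom-left corner of the MBR; its left edge is the part of this walk up to the last vertex on the top side of the MBR. The polygon has all its indents vertical, on the left side, and at different heights if (i) its horizontal perimeter is twice the width of its MBR; (ii) after the left edge the walk makes no upward step (so the left edge contains exactly $m$ downward steps, the indents); (iii) any two downward steps of the left edge are separated by an upward step (each indent is one unit deep) and start at different heights. Put $\Delta = 1-2x-2y-2xy+x^2+y^2$, let $\sqrt\Delta$ be its formal power series square root with constant term $1$, and let $$SP=\tfrac12\bigl(1-x-y-\sqrt\Delta\bigr),\qquad UP=\frac{xy}{\sqrt\Delta},\qquad \mathcal I=\Bigl(\frac{SP}{y}\Bigr)^2 ,$$ where $SP$ and $UP$ are formal power series in $x,y$ divisible by $y$. **Proposition.** For every $m\ge1$, the generating function of $m$-staircase (resp. $m$-unimodal) polygons with all indents vertical, on the left side, and at different heights,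 in which a polygon whose MBR has width $a$ and height $b$ has weight $x^ay^b$, equals $$\frac{y^{m+1}}{m!}\,\frac{\partial^{m-1}}{\partial y^{m-1}}\left(\mathcal I^{\,m}\,\frac{\partial}{\partial y}\,\frac{\mathcal Q}{y}\right),$$ where $\mathcal Q=SP$ (resp. $\mathcal Q=UP$). For $m=2$ this is $\frac{y^3}{2}\,\partial_y\bigl(\mathcal I^2\,\partial_y(\mathcal Q/y)\bigr)$. -/

import Mathlib

namespace MConvex

/-! ### Polygons on the square lattice -/

/-- A unit step of the square lattice: north, east, south or west. -/
inductive Step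
  | N | E | S | W
  deriving DecidableEq

instance : Fintype Step := ⟨{.N, .E, .S, .W}, fun s => by cases s <;> decide⟩

/-- The displacement of a step. -/
def Step.vec : Step → ℤ × ℤ
  | .N => (0, 1)
  | .E => (1, 0)
  | .S => (0, -1)
  | .W => (-1, 0)

/-- The vertex reached after the first `k` steps of the walk `w`, which starts at the origin. -/
def pos (w : List Step) (k : ℕ) : ℤ × ℤ := ((w.take k).map Step.vec).sum

/-- `w` is the boundary walk of a self-avoiding polygon: it closes up and visits no vertex twice
before that (the degenerate walk along one edge and back is excluded by its length). -/
structure IsPolygon (w : List Step) : Prop where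
  length_ge : 4 ≤ w.length
  closed : pos w w.length = 0
  simple : ∀ i j, i < j → j < w.length → pos w i ≠ pos w j

/-- The minimum bounding rectangle of `w` is `[0, a] × [0, b]`. As the walk starts at the origin,
the left and bottom sides are reached, and the bottom-left corner lies on the walk. -/
structure HasBox (a b : ℕ) (w : List Step) : Prop where
  inside : ∀ k ≤ w.length, 0 ≤ (pos w k).1 ∧ (pos w k).1 ≤ a ∧ 0 ≤ (pos w k).2 ∧ (pos w k).2 ≤ b
  right : ∃ k ≤ w.length, (pos w k).1 = a
  top : ∃ k ≤ w.length, (pos w k).2 = b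

/-- `w` is the boundary walk of an `m`-unimodal polygon of width `a` and height `b`: a
self-avoiding polygon through the bottom-left corner of its minimum bounding rectangle, whose
perimeter exceeds that of the rectangle by `2 * m`. The walk starts at this corner and runs
clockwise (its first step is north), so every such polygon, up to translation, has exactly one
boundary walk. -/
structure IsUnimodal (m a b : ℕ) (w : List Step) : Prop where
  polygon : IsPolygon w
  box : HasBox a b w
  clockwise : w.head? = some Step.N
  perimeter : w.length = 2 * (a + b) + 2 * m

/-- An `m`-staircase polygon also passes through the top-right corner of its minimum bounding
rectangle. -/
structure IsStaircase (m a b : ℕ) (w : List Step) : Prop extends IsUnimodal m a b w where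
  corner : ∃ k ≤ w.length, pos w k = ((a : ℤ), (b : ℤ))

/-- The step number `k` (counted from zero) of `w` lies on the left edge, that is, on the part of
the clockwise boundary walk from the bottom-left corner to the last vertex on the top side of the
minimum bounding rectangle. Here `b` is the height of the rectangle. -/
def OnLeftEdge (b : ℕ) (w : List Step) (k : ℕ) : Prop :=
  ∃ j, k < j ∧ j ≤ w.length ∧ (pos w j).2 = b

/-- All indents are vertical, one unit deep, on the left edge, and at different heights.

A vertical indent on the left edge, one unit deep, is a south step there (the edge rises, makes
one south step, and rises again); its height is the ordinate of that step. -/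
structure LeftIndented (a b : ℕ) (w : List Step) : Prop where
  /-- no horizontal indents: the horizontal perimeter is that of the bounding rectangle -/
  no_horizontal : w.count Step.E = a
  /-- no vertical indents elsewhere: after the left edge, the boundary never goes up again -/
  only_left : ∀ k, w[k]? = some Step.N → OnLeftEdge b w k
  /-- each indent is one unit deep: different south steps belong to different indents -/
  depth_one : ∀ i j, i < j → w[i]? = some Step.S → w[j]? = some Step.S → OnLeftEdge b w j →
    ∃ k, i < k ∧ k < j ∧ w[k]? = some Step.N
  /-- the indents are at different heights -/
  heights : ∀ i j, i < j → w[i]? = some Step.S → w[j]? = some Step.S → OnLeftEdge b w j →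
    (pos w i).2 ≠ (pos w j).2

/-- The `m`-staircase polygons of width `a` and height `b` whose indents are all vertical, on the
left edge, and at different heights. -/
def staircaseSet (m a b : ℕ) : Set (List Step) := {w | IsStaircase m a b w ∧ LeftIndented a b w}

/-- The `m`-unimodal polygons of width `a` and height `b` whose indents are all vertical, on the
left edge, and at different heights. -/
def unimodalSet (m a b : ℕ) : Set (List Step) := {w | IsUnimodal m a b w ∧ LeftIndented a b w}

theorem unimodalSet_finite (m a b : ℕ) : (unimodalSet m a b).Finite :=
  (List.finite_length_eq Step (2 * (a + b) + 2 * m)).subset fun _ h => h.1.perimeter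

theorem staircaseSet_finite (m a b : ℕ) : (staircaseSet m a b).Finite :=
  (unimodalSet_finite m a b).subset fun _ h => ⟨h.1.toIsUnimodal, h.2⟩

/-! ### Formal power series in `x` and `y` -/

/-- Formal power series in `x` (the variable `0`) and `y` (the variable `1`). -/
abbrev Series := MvPowerSeries (Fin 2) ℚ

noncomputable section

/-- The variable `x`. -/
def x : Series := MvPowerSeries.X 0

/-- The variable `y`. -/
def y : Series := MvPowerSeries.X 1

/-- The generating function of the polygons in `staircaseSet`, by width (`x`) and height (`y`)
of the minimum bounding rectangle. -/
def staircaseGF (m : ℕ) : Series := fun n => ((staircaseSet m (n 0) (n 1)).ncard : ℚ)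

/-- The generating function of the polygons in `unimodalSet`, by width (`x`) and height (`y`)
of the minimum bounding rectangle. -/
def unimodalGF (m : ℕ) : Series := fun n => ((unimodalSet m (n 0) (n 1)).ncard : ℚ)

/-- The partial derivative with respect to `y`. -/
def dy (f : Series) : Series := MvPowerSeries.pderiv ℚ (1 : Fin 2) f

/-- Division by `y` of a series that is divisible by `y`. -/
def divY (f : Series) : Series :=
  fun n => MvPowerSeries.coeff (n + Finsupp.single (1 : Fin 2) 1) f

theorem divY_mul (g : Series) : divY (y * g) = g := by
  ext n
  change MvPowerSeries.coeff (n + Finsupp.single (1 : Fin 2) 1) (MvPowerSeries.X 1 * g) = _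
  rw [add_comm, MvPowerSeries.X, MvPowerSeries.coeff_add_monomial_mul, one_mul]

theorem y_mul_divY {f : Series} (h : y ∣ f) : y * divY f = f := by
  obtain ⟨g, rfl⟩ := h
  rw [divY_mul]

/-- The discriminant `Δ`. -/
def Δ : Series := 1 - 2 * x - 2 * y - 2 * x * y + x ^ 2 + y ^ 2

/-- The square root of `Δ` with constant term `1`: the binomial series for `√(1 + t)` at
`t = Δ - 1`. -/
def sqrtΔ : Series := (PowerSeries.binomialSeries ℚ (1 / 2 : ℚ)).subst (Δ - 1)

theorem hasSubst_Δ : PowerSeries.HasSubst (Δ - 1) :=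
  PowerSeries.HasSubst.of_constantCoeff_zero (by simp [Δ, x, y])

theorem sqrtΔ_sq : sqrtΔ ^ 2 = Δ := by
  have h : (PowerSeries.binomialSeries ℚ (1 / 2 : ℚ)) * PowerSeries.binomialSeries ℚ (1 / 2 : ℚ)
      = 1 + PowerSeries.X := by
    rw [← PowerSeries.binomialSeries_add]
    have := PowerSeries.binomialSeries_nat (R := ℚ) (A := ℚ) 1
    norm_num at this ⊢
    exact this
  rw [sq, sqrtΔ, ← PowerSeries.subst_mul hasSubst_Δ, h, PowerSeries.subst_add hasSubst_Δ,
    PowerSeries.subst_X hasSubst_Δ, ← PowerSeries.coe_substAlgHom hasSubst_Δ, map_one]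
  ring

theorem constantCoeff_sqrtΔ : MvPowerSeries.constantCoeff sqrtΔ = 1 := by
  have h := PowerSeries.constantCoeff_subst_eq_zero (R := ℚ) (a := Δ - 1) (by simp [Δ, x, y])
    (PowerSeries.binomialSeries ℚ (1 / 2 : ℚ) - 1) (by simp)
  rw [← PowerSeries.coe_substAlgHom hasSubst_Δ, map_sub, map_one,
    PowerSeries.coe_substAlgHom hasSubst_Δ, map_sub, map_one, sub_eq_zero] at h
  exact h

/-- The staircase polygon generating function. -/
def SP : Series := MvPowerSeries.C (1 / 2 : ℚ) * (1 - x - y - sqrtΔ)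

/-- The generating function of pairs of directed walks, `1 / √Δ`. -/
def Z : Series := sqrtΔ⁻¹

/-- The unimodal polygon generating function. -/
def UP : Series := x * y * Z

/-- The generating function of a one-deep indent. -/
def I : Series := divY SP ^ 2

theorem y_dvd_UP : y ∣ UP := ⟨x * Z, by rw [UP]; ring⟩

theorem SP_mul : SP * (1 - x - y - SP) = x * y := by
  have h := sqrtΔ_sq
  have h2 : (MvPowerSeries.C (1 / 2 : ℚ) : Series) * 2 = 1 := by
    rw [show (2 : Series) = MvPowerSeries.C (2 : ℚ) from (map_ofNat _ 2).symm, ← map_mul]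
    norm_num
  rw [Δ] at h
  rw [SP]
  generalize (MvPowerSeries.C (1 / 2 : ℚ) : Series) = c at *
  linear_combination (-c ^ 2) * h +
    ((2 * c + 1) * x * y - c * (1 - x - y - sqrtΔ) * (1 - x - y)) * h2

theorem y_dvd_SP : y ∣ SP := by
  have hu : IsUnit (1 - x - y - SP) := by
    rw [MvPowerSeries.isUnit_iff_constantCoeff]
    simp [SP, x, y, constantCoeff_sqrtΔ]
  rw [← hu.dvd_mul_right, SP_mul]
  exact dvd_mul_left y x

end

end MConvex

/-!
A polygon with the prescribed indents is built from the bottom row upwards, its left edge and its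
right boundary growing together, and one records only the horizontal gap `d` between their ends. The
recursions are linear, and their solutions are geometric in `d`. Let `A` be the series of staircase
polygons divided by `y`, with a further variable `t` for the indents. A step up of the left edge has
weight `y`, while an indent adds two runs to the east, each of weight `A`. So `A` arises from the
series without indents by replacing `y` by `y + t A²`, and the same holds for the unimodal series.
Hence both series solve the transport equation `∂f/∂t = A² ∂f/∂y`, whose Taylor coefficients in `t`,
given that `A² = 𝓘` at `t = 0`, follow Lagrange's inversion formula.
-/

namespace MConvex

open IsLocalRing PowerSeries

section Burgers

variable {k R : Type*} [CommRing k] [CommRing R] [Algebra k R]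

/-- The extension of a derivation of `R` to `R⟦X⟧`, acting on the coefficients. -/
noncomputable def coeffDeriv (d : Derivation k R R) : Derivation k R⟦X⟧ R⟦X⟧ :=
  Derivation.mk'
    { toFun := fun f => PowerSeries.mk fun n => d (coeff n f)
      map_add' := fun f g => by ext n; simp
      map_smul' := fun q f => by ext n; simp }
    (fun f g => by
      ext n
      simp only [LinearMap.coe_mk, AddHom.coe_mk, coeff_mk, coeff_mul, map_sum, Derivation.leibniz,
        smul_eq_mul, map_add, Finset.sum_add_distrib]
      congr 1
      exact Finset.sum_equiv (Equiv.prodComm ℕ ℕ) (by simp [add_comm]) (by simp))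

variable (d : Derivation k R R)

@[simp] theorem coeff_coeffDeriv (f : R⟦X⟧) (n : ℕ) : coeff n (coeffDeriv d f) = d (coeff n f) := by
  simp [coeffDeriv]

@[simp] theorem coeffDeriv_X : coeffDeriv d (X : R⟦X⟧) = 0 := by
  ext1 n
  simp [coeff_X, apply_ite d]

@[simp] theorem coeffDeriv_C (r : R) : coeffDeriv d (C r) = C (d r) := by
  ext1 n
  simp [coeff_C, apply_ite d]

theorem constantCoeff_iterate_coeffDeriv (f : R⟦X⟧) (n : ℕ) :
    constantCoeff ((coeffDeriv d)^[n] f) = d^[n] (constantCoeff f) :=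
  Function.Semiconj.iterate_right (f := ⇑(constantCoeff (R := R)))
    (fun f => by simp only [← coeff_zero_eq_constantCoeff_apply, coeff_coeffDeriv]) n f

theorem derivative_coeffDeriv_comm :
    Function.Commute (derivative R : R⟦X⟧ → R⟦X⟧) (coeffDeriv d) := by
  intro f
  ext n
  have d_succ : d ((n : R) + 1) = 0 := mod_cast d.map_natCast (n + 1)
  simp [coeff_derivative, d_succ, mul_comm]

/-- The derivation `∂/∂X - φ · d` of `R⟦X⟧`. Its kernel consists of the solutions `f` of the
transport equation `∂f/∂X = φ · d f`; for `f = φ` this is the inviscid Burgers equation. -/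
noncomputable def transportDeriv (φ : R⟦X⟧) : Derivation k R⟦X⟧ R⟦X⟧ :=
  (derivative R).restrictScalars k - φ • coeffDeriv d

theorem transportDeriv_apply (φ f : R⟦X⟧) :
    transportDeriv d φ f = derivative R f - φ * coeffDeriv d f := rfl

theorem iterate_derivative_of_transport {φ B : R⟦X⟧} (hφ : transportDeriv d φ φ = 0)
    (hB : transportDeriv d φ B = 0) (m : ℕ) :
    (derivative R)^[m + 1] B = (coeffDeriv d)^[m] (φ ^ (m + 1) * coeffDeriv d B) := by
  rw [transportDeriv_apply, sub_eq_zero] at hφ hB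
  induction m with
  | zero => simpa using hB
  | succ m ih =>
    rw [Function.iterate_succ_apply', ih, (derivative_coeffDeriv_comm d).iterate_right m,
      Function.iterate_succ_apply]
    congr 1
    simp only [Derivation.leibniz, Derivation.leibniz_pow, (derivative_coeffDeriv_comm d).eq, hB,
      hφ, smul_eq_mul, nsmul_eq_mul, Nat.add_sub_cancel]
    push_cast
    ring

theorem factorial_mul_coeff_of_transport {φ B : R⟦X⟧} (hφ : transportDeriv d φ φ = 0)
    (hB : transportDeriv d φ B = 0) (m : ℕ) :
    ((m + 1).factorial : R) * coeff (m + 1) B =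
      d^[m] (constantCoeff φ ^ (m + 1) * d (constantCoeff B)) := by
  rw [← constantCoeff_iterate_derivative, iterate_derivative_of_transport d hφ hB,
    constantCoeff_iterate_coeffDeriv, map_mul, map_pow]
  simp only [← coeff_zero_eq_constantCoeff_apply, coeff_coeffDeriv]

end Burgers

section Rows

variable {S : Type*} [CommRing S]

/-- The weight `y + t A²` of a step up of the left edge to the next row: the row is crossed once
(`y`) or, at an indent, three times (`t`), with a walk of weight `A` on each of its two levels. -/
def rise (y t A : S) : S := y + t * A ^ 2

-- `A = r / (1 - r)` is the weight of a nonempty sequence of objects of weight `r`.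
theorem eq_one_add_mul {r A B D : S} (hA : A = r + r * A) (hB : B = D + r * B) :
    B = (1 + A) * D := by
  linear_combination (1 + A) * hB - B * hA

variable [IsLocalRing S]

/-- The recursions for the generating functions of the left edge within one row, indexed by the
distance `d` from the right boundary: `g` of the completed previous row, `u` of the new row, `v`
and `w` of the upper and the lower level of an indent, and `h` of the walks that have just left the
row. Steps to the east lower `d`. The last three conditions make the infinite sums hidden in the
recursions converge. -/
structure RowSystem (y t : S) (g u v w h : ℕ → S) : Prop where
  entered : ∀ d, u d = g d + u (d + 1)
  upper : ∀ d, v d = u (d + 1) + v (d + 1)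
  lower : ∀ d, w d = v (d + 1) + w (d + 1)
  raised : ∀ d, h d = y * u d + t * w d
  entered_mem : ∀ d, u d ∈ maximalIdeal S ^ d
  upper_mem : ∀ d, v d ∈ maximalIdeal S ^ d
  lower_mem : ∀ d, w d ∈ maximalIdeal S ^ d

theorem mem_pow_of_telescope {u v : ℕ → S} {n : ℕ} (hv : ∀ d, v d ∈ maximalIdeal S ^ n)
    (h : ∀ d, u d = v d + u (d + 1)) (hu : ∀ d, u d ∈ maximalIdeal S ^ d) (d : ℕ) :
    u d ∈ maximalIdeal S ^ n := by
  have descend : ∀ j, u (d + j) ∈ maximalIdeal S ^ n → u d ∈ maximalIdeal S ^ n := by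
    intro j
    induction j with
    | zero => exact id
    | succ j ih => exact fun hj => ih (h (d + j) ▸ add_mem (hv _) hj)
  exact descend n (Ideal.pow_le_pow_right (Nat.le_add_left n d) (hu (d + n)))

theorem shift_sub_mem_pow {u : ℕ → S} (hu : ∀ d, u d ∈ maximalIdeal S ^ d) (r : S) (d : ℕ) :
    u (d + 1) - r * u d ∈ maximalIdeal S ^ d :=
  sub_mem (Ideal.pow_le_pow_right d.le_succ (hu _)) (Ideal.mul_mem_left _ _ (hu d))

theorem eq_zero_of_forall_mem_maximalIdeal_pow [IsNoetherianRing S] {f : S}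
    (h : ∀ n, f ∈ maximalIdeal S ^ n) : f = 0 :=
  IsHausdorff.haus (I := maximalIdeal S) inferInstance f fun n => by
    simpa [SModEq.zero] using h n

namespace RowSystem

variable {x y t r : S} {g u v w h : ℕ → S}

theorem shift_sub (H : RowSystem y t g u v w h) (r : S) :
    RowSystem y t (fun d => g (d + 1) - r * g d) (fun d => u (d + 1) - r * u d)
      (fun d => v (d + 1) - r * v d) (fun d => w (d + 1) - r * w d)
      (fun d => h (d + 1) - r * h d) where
  entered d := by rw [H.entered d, H.entered (d + 1)]; ring
  upper d := by rw [H.upper d, H.upper (d + 1)]; ring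
  lower d := by rw [H.lower d, H.lower (d + 1)]; ring
  raised d := by rw [H.raised d, H.raised (d + 1)]; ring
  entered_mem := shift_sub_mem_pow H.entered_mem r
  upper_mem := shift_sub_mem_pow H.upper_mem r
  lower_mem := shift_sub_mem_pow H.lower_mem r

theorem mem_pow (H : RowSystem y t g u v w h) {n : ℕ} (hg : ∀ d, g d ∈ maximalIdeal S ^ n) :
    (∀ d, u d ∈ maximalIdeal S ^ n) ∧ (∀ d, v d ∈ maximalIdeal S ^ n) ∧
      ∀ d, w d ∈ maximalIdeal S ^ n := by
  have hu := mem_pow_of_telescope hg H.entered H.entered_mem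
  have hv := mem_pow_of_telescope (fun d => hu (d + 1)) H.upper H.upper_mem
  exact ⟨hu, hv, mem_pow_of_telescope (fun d => hv (d + 1)) H.lower H.lower_mem⟩

theorem raised_mem_pow_succ (H : RowSystem y t g u v w h) (hy : y ∈ maximalIdeal S)
    (ht : t ∈ maximalIdeal S) {n : ℕ} (hg : ∀ d, g d ∈ maximalIdeal S ^ n) (d : ℕ) :
    h d ∈ maximalIdeal S ^ (n + 1) := by
  obtain ⟨hu, -, hw⟩ := H.mem_pow hg
  rw [H.raised, pow_succ']
  exact add_mem (Ideal.mul_mem_mul hy (hu d)) (Ideal.mul_mem_mul ht (hw d))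

variable [IsNoetherianRing S]

theorem geometric (H : RowSystem y t g u v w h) (hg : ∀ d, g (d + 1) = r * g d) :
    (∀ d, u (d + 1) = r * u d) ∧ (∀ d, v (d + 1) = r * v d) ∧ ∀ d, w (d + 1) = r * w d := by
  have mem n := (H.shift_sub r).mem_pow (n := n) fun d => by simp [hg]
  simp only [← sub_eq_zero (b := r * _)]
  exact ⟨fun d => eq_zero_of_forall_mem_maximalIdeal_pow fun n => (mem n).1 d,
    fun d => eq_zero_of_forall_mem_maximalIdeal_pow fun n => (mem n).2.1 d,
    fun d => eq_zero_of_forall_mem_maximalIdeal_pow fun n => (mem n).2.2 d⟩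

variable {A : S} {g' u' v' w' h' : ℕ → S}

theorem entered_eq (H : RowSystem y t g u v w h) (hg : ∀ d, g (d + 1) = r * g d)
    (hA : A = r + r * A) (d : ℕ) : u d = (1 + A) * g d :=
  eq_one_add_mul hA (by rw [← (H.geometric hg).1]; exact H.entered d)

theorem raised_eq (H : RowSystem y t g u v w h) (hg : ∀ d, g (d + 1) = r * g d)
    (hA : A = r + r * A) (d : ℕ) : h d = rise y t A * u d := by
  obtain ⟨hu, hv, hw⟩ := H.geometric hg
  have v_eq : v d = (1 + A) * (r * u d) :=
    eq_one_add_mul hA (by rw [← hu, ← hv]; exact H.upper d)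
  have w_eq : w d = (1 + A) * (r * v d) :=
    eq_one_add_mul hA (by rw [← hv, ← hw]; exact H.lower d)
  rw [H.raised, rise]
  linear_combination t * w_eq + t * r * (1 + A) * v_eq - t * u d * (A + r * (1 + A)) * hA

-- The defect `g (d + 1) - g 1 * g d` satisfies the same linear recursions as `g`, but vanishes at
-- `d = 0`; each round of the recursions multiplies by `x`, `y` or `t`, so it lies in every power of
-- the maximal ideal.
theorem geometric_of_widening (H : RowSystem y t (fun d => g (d + 1)) u v w h)
    (hx : x ∈ maximalIdeal S) (hy : y ∈ maximalIdeal S) (ht : t ∈ maximalIdeal S)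
    (g_zero : g 0 = 1) (g_succ : ∀ d, g (d + 1) = x * g d + h d) (d : ℕ) :
    g (d + 1) = g 1 * g d := by
  have mem_pow : ∀ n d, g (d + 1) - g 1 * g d ∈ maximalIdeal S ^ n := by
    intro n
    induction n with
    | zero => simp
    | succ n ih =>
      rintro (_ | d)
      · simp [g_zero]
      · have step : g (d + 1 + 1) - g 1 * g (d + 1) =
            x * (g (d + 1) - g 1 * g d) + (h (d + 1) - g 1 * h d) := by
          linear_combination g_succ (d + 1) - g 1 * g_succ d
        rw [step, pow_succ']
        refine add_mem (Ideal.mul_mem_mul hx (ih d)) ?_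
        rw [← pow_succ']
        exact (H.shift_sub (g 1)).raised_mem_pow_succ hy ht (fun d => ih (d + 1)) d
  exact sub_eq_zero.1 (eq_zero_of_forall_mem_maximalIdeal_pow fun n => mem_pow n d)

theorem geometric_of_shrinking (H : RowSystem y t g' u' v' w' h')
    (hy : y ∈ maximalIdeal S) (ht : t ∈ maximalIdeal S) (h_succ : ∀ d, h (d + 1) = r * h d)
    (g_mem : ∀ d, g' d ∈ maximalIdeal S ^ d)
    (g_eq : ∀ d, g' d = g' (d + 1) + h (d + 1) + h' d) (d : ℕ) : g' (d + 1) = r * g' d := by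
  have mem_pow : ∀ n d, g' (d + 1) - r * g' d ∈ maximalIdeal S ^ n := by
    intro n
    induction n with
    | zero => simp
    | succ n ih =>
      refine mem_pow_of_telescope ((H.shift_sub r).raised_mem_pow_succ hy ht ih) (fun d => ?_)
        (shift_sub_mem_pow g_mem r)
      rw [g_eq d, g_eq (d + 1), h_succ]
      ring
  exact sub_eq_zero.1 (eq_zero_of_forall_mem_maximalIdeal_pow fun n => mem_pow n d)

theorem entered_zero_eq (H : RowSystem y t (fun d => g (d + 1)) u v w h)
    (hg : ∀ d, g (d + 1) = g 1 * g d) : u 0 = g 1 + g 1 * u 0 := by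
  rw [← (H.geometric fun d => hg (d + 1)).1]
  exact H.entered 0

theorem staircase_equation (H : RowSystem y t (fun d => g (d + 1)) u v w h)
    (hx : x ∈ maximalIdeal S) (hy : y ∈ maximalIdeal S) (ht : t ∈ maximalIdeal S)
    (g_zero : g 0 = 1) (g_succ : ∀ d, g (d + 1) = x * g d + h d) :
    u 0 * (1 - x - rise y t (u 0) - rise y t (u 0) * u 0) = x := by
  have hg := H.geometric_of_widening hx hy ht g_zero g_succ
  have hA := H.entered_zero_eq hg
  have h_zero := H.raised_eq (fun d => hg (d + 1)) hA 0
  have g_one : g 1 = x + h 0 := by rw [g_succ 0, g_zero, mul_one]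
  linear_combination hA + (1 + u 0) * (g_one + h_zero)

theorem unimodal_equation (H : RowSystem y t (fun d => g (d + 1)) u v w h)
    (H' : RowSystem y t g' u' v' w' h')
    (hx : x ∈ maximalIdeal S) (hy : y ∈ maximalIdeal S) (ht : t ∈ maximalIdeal S)
    (g_zero : g 0 = 1) (g_succ : ∀ d, g (d + 1) = x * g d + h d)
    (g_mem : ∀ d, g' d ∈ maximalIdeal S ^ d)
    (g_eq : ∀ d, g' d = g' (d + 1) + h (d + 1) + h' d) :
    (u 0 + u' 0) * (1 - x - rise y t (u 0) - 2 * rise y t (u 0) * u 0) = x := by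
  have hg := H.geometric_of_widening hx hy ht g_zero g_succ
  have hA := H.entered_zero_eq hg
  have stair := H.staircase_equation hx hy ht g_zero g_succ
  have h_eq := H.raised_eq (fun d => hg (d + 1)) hA
  have h_succ (d : ℕ) : h (d + 1) = g 1 * h d := by
    rw [h_eq, h_eq, (H.geometric fun d => hg (d + 1)).1, mul_left_comm]
  have hg' := H'.geometric_of_shrinking hy ht h_succ g_mem g_eq
  have u'_zero : u' 0 = (1 + u 0) * g' 0 := H'.entered_eq hg' hA 0
  have h'_zero : h' 0 = rise y t (u 0) * u' 0 := H'.raised_eq hg' hA 0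
  have g'_zero : g' 0 = (1 + u 0) * (g 1 * h 0 + h' 0) :=
    eq_one_add_mul hA (by linear_combination g_eq 0 + hg' 0 + h_succ 0)
  have h_zero := h_eq 0
  generalize u 0 = A at *
  generalize u' 0 = K at *
  generalize rise y t A = Y at *
  have mul_ratio : (1 + A) * g 1 = A := by linear_combination -hA
  have ratio_inv : (1 - g 1) * (1 + A) = 1 := by linear_combination hA
  have K_eq : K = (1 + A) * (A * (Y * A) + (1 + A) * (Y * K)) := by
    linear_combination u'_zero + (1 + A) * g'_zero + (1 + A) * (1 + A) * g 1 * h_zero +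
      (1 + A) * (1 + A) * h'_zero + (1 + A) * (Y * A) * mul_ratio
  have factor_eq : 1 - x - Y - 2 * Y * A = 1 - g 1 - Y * (1 + A) := by
    linear_combination (1 - g 1) * stair - (1 - x - Y * A) * ratio_inv
  linear_combination stair + K * factor_eq + (1 - g 1) * K_eq +
    (Y * A ^ 2 + Y * (1 + A) * K) * ratio_inv

end RowSystem

end Rows

section AlgebraicEquations

variable {k R : Type*} [CommRing k] [CommRing R] [Algebra k R] (d : Derivation k R R) {x y : R}
  {A B : R⟦X⟧}

theorem transportDeriv_rise (hy : d y = 1) :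
    transportDeriv d (A ^ 2) (rise (C y) X A) = 2 * X * A * transportDeriv d (A ^ 2) A := by
  simp only [rise, transportDeriv_apply, map_add, Derivation.leibniz, Derivation.leibniz_pow,
    derivative_C, derivative_X, coeffDeriv_C, coeffDeriv_X, hy, smul_eq_mul, nsmul_eq_mul, map_one]
  push_cast
  ring

theorem transportDeriv_C (φ : R⟦X⟧) {r : R} (hr : d r = 0) : transportDeriv d φ (C r) = 0 := by
  simp [transportDeriv_apply, hr]

variable [IsLocalRing R]

theorem C_mem_maximalIdeal {r : R} (hr : r ∈ maximalIdeal R) : C r ∈ maximalIdeal R⟦X⟧ := by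
  rwa [mem_maximalIdeal, mem_nonunits_iff, isUnit_iff_constantCoeff, constantCoeff_C]

theorem X_mem_maximalIdeal : (X : R⟦X⟧) ∈ maximalIdeal R⟦X⟧ := by
  simp [mem_maximalIdeal, mem_nonunits_iff, isUnit_iff_constantCoeff]

theorem isUnit_of_constantCoeff_eq (hx : x ∈ maximalIdeal R) (hy : y ∈ maximalIdeal R) {f : R⟦X⟧}
    {p q : R} (hf : constantCoeff f = 1 - (x * p + y * q)) : IsUnit f := by
  rw [isUnit_iff_constantCoeff, hf]
  exact isUnit_one_sub_self_of_mem_nonunits _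
    (add_mem (Ideal.mul_mem_right p _ hx) (Ideal.mul_mem_right q _ hy))

theorem transport_of_staircase_equation (hx : x ∈ maximalIdeal R) (hy : y ∈ maximalIdeal R)
    (hdx : d x = 0) (hdy : d y = 1)
    (hA : A * (1 - C x - rise (C y) X A - rise (C y) X A * A) = C x) :
    transportDeriv d (A ^ 2) A = 0 := by
  set Y := rise (C y) X A with Y_def
  have hT := congrArg (transportDeriv d (A ^ 2)) hA
  simp only [map_sub, Derivation.leibniz, Derivation.map_one_eq_zero, transportDeriv_C d _ hdx,
    Y_def, transportDeriv_rise d hdy, smul_eq_mul] at hT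
  have unit : IsUnit (1 - C x - Y - 2 * Y * A - 2 * X * A ^ 2 * (1 + A)) :=
    isUnit_of_constantCoeff_eq hx hy (p := 1) (q := 1 + 2 * constantCoeff A) (by
      simp only [Y_def, rise, map_sub, map_add, map_mul, map_pow, map_one, map_ofNat,
        constantCoeff_C, constantCoeff_X]
      ring)
  refine unit.mul_right_eq_zero.1 ?_
  rw [Y_def]
  linear_combination hT

theorem transport_of_unimodal_equation (hx : x ∈ maximalIdeal R) (hy : y ∈ maximalIdeal R)
    (hdx : d x = 0) (hdy : d y = 1) (hA : transportDeriv d (A ^ 2) A = 0)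
    (hB : B * (1 - C x - rise (C y) X A - 2 * rise (C y) X A * A) = C x) :
    transportDeriv d (A ^ 2) B = 0 := by
  set Y := rise (C y) X A with Y_def
  have hT := congrArg (transportDeriv d (A ^ 2)) hB
  have two : transportDeriv d (A ^ 2) (2 : R⟦X⟧) = 0 := (transportDeriv d (A ^ 2)).map_natCast 2
  simp only [map_sub, Derivation.leibniz, Derivation.map_one_eq_zero, transportDeriv_C d _ hdx,
    Y_def, transportDeriv_rise d hdy, hA, two, smul_eq_mul] at hT
  have unit : IsUnit (1 - C x - Y - 2 * Y * A) :=
    isUnit_of_constantCoeff_eq hx hy (p := 1) (q := 1 + 2 * constantCoeff A) (by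
      simp only [Y_def, rise, map_sub, map_add, map_mul, map_pow, map_one, map_ofNat,
        constantCoeff_C, constantCoeff_X]
      ring)
  refine unit.mul_right_eq_zero.1 ?_
  rw [Y_def]
  linear_combination hT

end AlgebraicEquations

section Coefficients

variable {A B : Series⟦X⟧}

theorem constantCoeff_x : MvPowerSeries.constantCoeff x = 0 := by simp [x]

theorem constantCoeff_y : MvPowerSeries.constantCoeff y = 0 := by simp [y]

theorem x_mem_maximalIdeal : x ∈ maximalIdeal Series := by
  simp [mem_maximalIdeal, mem_nonunits_iff, MvPowerSeries.isUnit_iff_constantCoeff, constantCoeff_x]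

theorem y_mem_maximalIdeal : y ∈ maximalIdeal Series := by
  simp [mem_maximalIdeal, mem_nonunits_iff, MvPowerSeries.isUnit_iff_constantCoeff, constantCoeff_y]

theorem pderiv_x : MvPowerSeries.pderiv ℚ (1 : Fin 2) x = 0 :=
  MvPowerSeries.pderiv_X_of_ne (by decide)

theorem pderiv_y : MvPowerSeries.pderiv ℚ (1 : Fin 2) y = 1 := MvPowerSeries.pderiv_X_self

theorem constantCoeff_rise : constantCoeff (rise (C y) X A) = y := by simp [rise]

theorem sqrtΔ_eq : sqrtΔ = 1 - x - y - 2 * SP := by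
  have half : (MvPowerSeries.C (1 / 2 : ℚ) : Series) * 2 = 1 := by
    rw [← map_ofNat MvPowerSeries.C 2, ← map_mul]
    norm_num
  rw [SP]
  linear_combination (1 - x - y - sqrtΔ) * half

theorem sqrtΔ_mul_Z : sqrtΔ * Z = 1 :=
  MvPowerSeries.mul_inv_cancel _ (by simp [constantCoeff_sqrtΔ])

theorem constantCoeff_eq_divY_SP
    (hA : A * (1 - C x - rise (C y) X A - rise (C y) X A * A) = C x) :
    constantCoeff A = divY SP := by
  have h := congrArg constantCoeff hA
  simp only [map_mul, map_sub, map_one, constantCoeff_C, constantCoeff_rise] at h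
  -- `y * constantCoeff A` and `SP` are roots of the same quadratic polynomial.
  have quadratic : (y * constantCoeff A - SP) * (1 - x - y - y * constantCoeff A - SP) = 0 := by
    linear_combination y * h - SP_mul
  have other_root : 1 - x - y - y * constantCoeff A - SP ≠ 0 := fun h0 => by
    have := congrArg MvPowerSeries.constantCoeff h0
    simp [constantCoeff_x, constantCoeff_y, SP, constantCoeff_sqrtΔ] at this
  rw [← sub_eq_zero.1 ((mul_eq_zero.1 quadratic).resolve_right other_root), divY_mul]

theorem constantCoeff_eq_divY_UP (hA : constantCoeff A = divY SP)
    (hB : B * (1 - C x - rise (C y) X A - 2 * rise (C y) X A * A) = C x) :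
    constantCoeff B = divY UP := by
  have h := congrArg constantCoeff hB
  simp only [map_mul, map_sub, map_one, map_ofNat, constantCoeff_C, constantCoeff_rise, hA] at h
  rw [show UP = y * (x * Z) by rw [UP]; ring, divY_mul]
  linear_combination Z * h - constantCoeff B * sqrtΔ_mul_Z + constantCoeff B * Z * sqrtΔ_eq +
    2 * constantCoeff B * Z * y_mul_divY y_dvd_SP

theorem coeff_eq_of_transport {Q : Series}
    (hA : transportDeriv (MvPowerSeries.pderiv ℚ (1 : Fin 2)) (A ^ 2) A = 0)
    (hB : transportDeriv (MvPowerSeries.pderiv ℚ (1 : Fin 2)) (A ^ 2) B = 0)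
    (hSP : constantCoeff A = divY SP) (hQ : constantCoeff B = divY Q) (m : ℕ) :
    coeff (m + 1) B = MvPowerSeries.C (1 / ((m + 1).factorial : ℚ)) *
      dy^[m] (I ^ (m + 1) * dy (divY Q)) := by
  have hφ : transportDeriv (MvPowerSeries.pderiv ℚ (1 : Fin 2)) (A ^ 2) (A ^ 2) = 0 := by
    rw [Derivation.leibniz_pow, hA, smul_zero, smul_zero]
  have lagrange : ((m + 1).factorial : Series) * coeff (m + 1) B =
      dy^[m] (I ^ (m + 1) * dy (divY Q)) := by
    rw [I, ← hSP, ← hQ, ← map_pow]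
    exact factorial_mul_coeff_of_transport _ hφ hB m
  rw [← lagrange, ← mul_assoc, ← map_natCast (MvPowerSeries.C (σ := Fin 2) (R := ℚ)), ← map_mul,
    one_div_mul_cancel (by exact_mod_cast (m + 1).factorial_ne_zero), map_one, one_mul]

end Coefficients

section GeneratingSeries

variable {α β γ : Type*}

/-- The generating series of a family of finite sets: its coefficient at `xᵃ yᵖ Xᵐ`, where `X` is
the outer variable, is the number of elements of `U a p m`. -/
noncomputable def genSeries (U : ℕ → ℕ → ℕ → Set α) : Series⟦X⟧ :=
  PowerSeries.mk fun m => fun e => ((U (e 0) (e 1) m).ncard : ℚ)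

theorem coeff_genSeries (U : ℕ → ℕ → ℕ → Set α) (m : ℕ) (e : Fin 2 →₀ ℕ) :
    MvPowerSeries.coeff e (coeff m (genSeries U)) = (U (e 0) (e 1) m).ncard :=
  congrArg (MvPowerSeries.coeff e) (coeff_mk m _)

theorem ncard_image_union_image {A : Set α} {B : Set β} {f : α → γ} {g : β → γ}
    (hf : f.Injective) (hg : g.Injective) (hfin : (f '' A ∪ g '' B).Finite)
    (hdisj : ∀ a ∈ A, ∀ b ∈ B, f a ≠ g b) : (f '' A ∪ g '' B).ncard = A.ncard + B.ncard := by
  obtain ⟨hA, hB⟩ := Set.finite_union.1 hfin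
  rw [Set.ncard_union_eq (Set.disjoint_image_image hdisj) hA hB, Set.ncard_image_of_injective _ hf,
    Set.ncard_image_of_injective _ hg]

theorem genSeries_eq_add {U : ℕ → ℕ → ℕ → Set γ} {A : ℕ → ℕ → ℕ → Set α}
    {B : ℕ → ℕ → ℕ → Set β} {f : α → γ} {g : β → γ} (hf : f.Injective) (hg : g.Injective)
    (hfin : ∀ a p m, (U a p m).Finite) (hU : ∀ a p m, U a p m = f '' A a p m ∪ g '' B a p m)
    (hdisj : ∀ a p m, ∀ q ∈ A a p m, ∀ r ∈ B a p m, f q ≠ g r) :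
    genSeries U = genSeries A + genSeries B := by
  ext m e
  rw [map_add, map_add]
  simp only [coeff_genSeries]
  rw [hU, ncard_image_union_image hf hg (hU .. ▸ hfin ..) (hdisj _ _ m), Nat.cast_add]

theorem coeff_X_mul_series (i : Fin 2) (f : Series) (e : Fin 2 →₀ ℕ) :
    MvPowerSeries.coeff e (MvPowerSeries.X i * f) =
      if e i = 0 then 0 else MvPowerSeries.coeff (e - Finsupp.single i 1) f := by
  classical
  simp [MvPowerSeries.X, MvPowerSeries.coeff_monomial_mul, Finsupp.single_le_iff,
    Nat.one_le_iff_ne_zero]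

theorem C_x_mul_genSeries (U : ℕ → ℕ → ℕ → Set α) :
    C x * genSeries U = genSeries fun a p m => {q | ∃ a', a' + 1 = a ∧ q ∈ U a' p m} := by
  ext m e
  rw [coeff_C_mul, x, coeff_X_mul_series]
  simp only [coeff_genSeries]
  cases h : e 0 <;> simp [h]

theorem C_y_mul_genSeries (U : ℕ → ℕ → ℕ → Set α) :
    C y * genSeries U = genSeries fun a p m => {q | ∃ p', p' + 1 = p ∧ q ∈ U a p' m} := by
  ext m e
  rw [coeff_C_mul, y, coeff_X_mul_series]
  simp only [coeff_genSeries]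
  cases h : e 1 <;> simp [h]

theorem X_mul_genSeries (U : ℕ → ℕ → ℕ → Set α) :
    X * genSeries U = genSeries fun a p m => {q | ∃ m', m' + 1 = m ∧ q ∈ U a p m'} := by
  ext (_ | m) e
  · rw [coeff_zero_X_mul, coeff_genSeries]
    simp
  · simp [coeff_succ_X_mul, coeff_genSeries]

theorem genSeries_mem_maximalIdeal_pow {U : ℕ → ℕ → ℕ → Set α} {d : ℕ}
    (hU : ∀ a p m, a < d → U a p m = ∅) : genSeries U ∈ maximalIdeal Series⟦X⟧ ^ d := by
  have dvd (m : ℕ) : x ^ d ∣ coeff m (genSeries U) :=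
    MvPowerSeries.X_pow_dvd_iff.2 fun e he => by rw [coeff_genSeries, hU _ _ _ he]; simp
  choose f hf using dvd
  have factor : genSeries U = C x ^ d * PowerSeries.mk f := by
    ext1 m
    rw [← map_pow, coeff_C_mul, coeff_mk, hf]
  rw [factor]
  exact Ideal.mul_mem_right _ _ (Ideal.pow_mem_pow (C_mem_maximalIdeal x_mem_maximalIdeal) d)

end GeneratingSeries

/-- The stages in the construction of a polygon from the bottom to the top. The Boolean tells
whether the right boundary has begun to move to the left. -/
inductive Stage
  /-- the right boundary of the last row is at its final place and has only moved to the right -/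
  | widening
  /-- the right boundary of the last row is at its place and has begun to move to the left -/
  | shrinking
  /-- the right boundary has been extended to the next row -/
  | entered (b : Bool)
  /-- the left edge is on the upper level of an indent -/
  | upper (b : Bool)
  /-- the left edge is on the lower level of an indent, after the step down -/
  | lower (b : Bool)
  /-- the left edge has just been extended to the top of the new row -/
  | raised (b : Bool)

open Step Stage

/-- `Grow s d a p m L R`: the reversed initial part `L` and the final part `R` of a boundary walk
are the left edge and the right boundary of the rows up to some height. The polygon has width at
least `a`, `p` of its rows above the first are crossed once, and `m` three times by the left edge.
The gap between the end of `L` and the start of `R` is `d` in stage `widening`, and `d + 1` in the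
other stages. -/
inductive Grow : Stage → ℕ → ℕ → ℕ → ℕ → List Step → List Step → Prop
  | base : Grow widening 0 0 0 0 [N] []
  | widen {d a p m L R} : Grow widening d a p m L R → Grow widening (d + 1) (a + 1) p m L (W :: R)
  | settle {d a p m L R} : Grow (raised false) d a p m L R → Grow widening (d + 1) a p m L R
  | enterWide {d a p m L R} : Grow widening (d + 1) a p m L R →
      Grow (entered false) d a p m L (S :: R)
  | enterShrink {d a p m L R} : Grow shrinking d a p m L R → Grow (entered true) d a p m L (S :: R)
  | east {b d a p m L R} : Grow (entered b) (d + 1) a p m L R → Grow (entered b) d a p m (E :: L) R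
  | indent {b d a p m L R} : Grow (entered b) (d + 1) a p m L R →
      Grow (upper b) d a p m (E :: N :: L) R
  | eastUpper {b d a p m L R} : Grow (upper b) (d + 1) a p m L R → Grow (upper b) d a p m (E :: L) R
  | descend {b d a p m L R} : Grow (upper b) (d + 1) a p m L R →
      Grow (lower b) d a p m (E :: S :: L) R
  | eastLower {b d a p m L R} : Grow (lower b) (d + 1) a p m L R → Grow (lower b) d a p m (E :: L) R
  | raise {b d a p m L R} : Grow (entered b) d a p m L R → Grow (raised b) d a (p + 1) m (N :: L) R
  | raiseIndent {b d a p m L R} : Grow (lower b) d a p m L R →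
      Grow (raised b) d a p (m + 1) (N :: L) R
  | turn {d a p m L R} : Grow (raised false) (d + 1) a p m L R → Grow shrinking d a p m L (E :: R)
  | shrink {d a p m L R} : Grow shrinking (d + 1) a p m L R → Grow shrinking d a p m L (E :: R)
  | keep {d a p m L R} : Grow (raised true) d a p m L R → Grow shrinking d a p m L R

/-- The traits of the two walks by which the last step of the construction is recognized. -/
def Shape : Stage → List Step → List Step → Prop
  | widening, L, R => L.head? = some N ∧ E ∉ R
  | shrinking, L, R => L.head? = some N ∧ E ∈ R
  | entered b, L, R => (L.dropWhile (· = E)).head? = some N ∧ R.head? = some S ∧ (E ∈ R ↔ b)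
  | upper b, L, R => L.head? = some E ∧ R.head? = some S ∧ (E ∈ R ↔ b)
  | lower b, L, R => L.head? = some E ∧ (L.dropWhile (· = E)).head? = some S ∧
      R.head? = some S ∧ (E ∈ R ↔ b)
  | raised b, L, R => L.head? = some N ∧ R.head? = some S ∧ (E ∈ R ↔ b)

/-- The difference between the gap and the parameter `d` in `Grow`. -/
def Stage.offset : Stage → ℕ
  | widening => 0
  | _ => 1

/-- The term depending on the stage in the bound `Grow.length_le` for the length of the walks. -/
def Stage.slack : Stage → ℕ
  | widening | shrinking | raised _ => 1
  | entered _ => 2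
  | upper _ => 3
  | lower _ => 4

section Grow

variable {s : Stage} {d a p m : ℕ} {L R : List Step}

theorem Grow.shape (h : Grow s d a p m L R) : Shape s L R := by
  induction h with
  | enterWide _ ih | enterShrink _ ih =>
    obtain ⟨L', rfl⟩ := List.head?_eq_some_iff.1 ih.1
    simp_all [Shape]
  | _ => simp_all [Shape]

theorem Grow.length_le (h : Grow s d a p m L R) :
    L.length + R.length + (d + s.offset) ≤ 2 * a + 2 * p + 4 * m + s.slack := by
  induction h <;> simp only [Stage.slack, Stage.offset, List.length_cons, List.length_nil] at * <;>
    omega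

theorem Grow.le_width (h : Grow s d a p m L R) : d + s.offset ≤ a := by
  induction h <;> simp only [Stage.offset] at * <;> omega

/-- The pairs of walks in a given stage. -/
def growSet (s : Stage) (d a p m : ℕ) : Set (List Step × List Step) :=
  {q | Grow s d a p m q.1 q.2}

theorem growSet_finite (s : Stage) (d a p m : ℕ) : (growSet s d a p m).Finite := by
  refine ((List.finite_length_le Step (2 * a + 2 * p + 4 * m + s.slack)).prod
    (List.finite_length_le Step (2 * a + 2 * p + 4 * m + s.slack))).subset fun q hq => ?_
  have := Grow.length_le hq
  exact ⟨by simp only [Set.mem_ofPred_eq]; omega, by simp only [Set.mem_ofPred_eq]; omega⟩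

/-- The generating function of the pairs of walks in a given stage: `x` marks the width, `y` the
rows above the first that are crossed once by the left edge, and the outer variable those crossed
three times. -/
noncomputable def growSeries (s : Stage) (d : ℕ) : Series⟦X⟧ := genSeries (growSet s d)

theorem growSeries_mem (s : Stage) (d : ℕ) : growSeries s d ∈ maximalIdeal Series⟦X⟧ ^ d :=
  genSeries_mem_maximalIdeal_pow fun _ _ _ ha =>
    Set.eq_empty_of_forall_notMem fun _ hq => by have := Grow.le_width hq; omega

theorem growSeries_widening_zero : growSeries widening 0 = 1 := by
  have growSet_eq (a p m : ℕ) : growSet widening 0 a p m =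
      {q | (a = 0 ∧ p = 0 ∧ m = 0) ∧ q = ([N], [])} := by
    ext ⟨L, R⟩
    constructor
    · rintro ⟨⟩
      simp
    · rintro ⟨⟨rfl, rfl, rfl⟩, ⟨⟩⟩
      exact .base
  classical
  ext m e
  have e_eq_zero : e = 0 ↔ e 0 = 0 ∧ e 1 = 0 := by simp [Finsupp.ext_iff, Fin.forall_fin_two]
  rw [growSeries, coeff_genSeries, growSet_eq, coeff_one]
  by_cases hm : m = 0 <;> by_cases he : e = 0 <;>
    simp [hm, he, MvPowerSeries.coeff_one, ← e_eq_zero]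

theorem injective_append_left (l : List Step) :
    (Prod.map (l ++ ·) id : List Step × List Step → List Step × List Step).Injective :=
  (List.append_right_injective l).prodMap Function.injective_id

theorem injective_append_right (l : List Step) :
    (Prod.map id (l ++ ·) : List Step × List Step → List Step × List Step).Injective :=
  Function.injective_id.prodMap (List.append_right_injective l)

theorem growSeries_widening_succ (d : ℕ) :
    growSeries widening (d + 1) = C x * growSeries widening d + growSeries (raised false) d := by
  simp only [growSeries, C_x_mul_genSeries]
  refine genSeries_eq_add (injective_append_right [W]) Function.injective_id (growSet_finite _ _)
    (fun a p m => ?_) fun a p m q _ r hr h => ?_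
  · ext ⟨L, R⟩
    constructor
    · intro h
      cases h with
      | @widen _ _ _ _ _ R h => exact .inl ⟨(L, R), ⟨_, rfl, h⟩, rfl⟩
      | settle h => exact .inr ⟨(_, _), h, rfl⟩
    · rintro (⟨_, ⟨_, rfl, h⟩, ⟨⟩⟩ | ⟨_, h, ⟨⟩⟩)
      exacts [h.widen, h.settle]
  · obtain rfl : _ = r := h
    simpa using (Grow.shape hr).2.1

theorem growSeries_entered_false (d : ℕ) : growSeries (entered false) d =
    growSeries widening (d + 1) + growSeries (entered false) (d + 1) := by
  refine genSeries_eq_add (injective_append_right [S]) (injective_append_left [E])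
    (growSet_finite _ _) (fun a p m => ?_) fun a p m ⟨L, R⟩ hq ⟨L', R'⟩ _ h => ?_
  · ext ⟨L, R⟩
    constructor
    · intro h
      cases h with
      | @enterWide _ _ _ _ _ R h => exact .inl ⟨(L, R), h, rfl⟩
      | east h => exact .inr ⟨(_, _), h, rfl⟩
    · rintro (⟨_, h, ⟨⟩⟩ | ⟨_, h, ⟨⟩⟩)
      exacts [h.enterWide, h.east]
  · cases h
    simpa using (Grow.shape hq).1

theorem growSeries_entered_true (d : ℕ) : growSeries (entered true) d =
    growSeries shrinking d + growSeries (entered true) (d + 1) := by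
  refine genSeries_eq_add (injective_append_right [S]) (injective_append_left [E])
    (growSet_finite _ _) (fun a p m => ?_) fun a p m ⟨L, R⟩ hq ⟨L', R'⟩ _ h => ?_
  · ext ⟨L, R⟩
    constructor
    · intro h
      cases h with
      | @enterShrink _ _ _ _ _ R h => exact .inl ⟨(L, R), h, rfl⟩
      | east h => exact .inr ⟨(_, _), h, rfl⟩
    · rintro (⟨_, h, ⟨⟩⟩ | ⟨_, h, ⟨⟩⟩)
      exacts [h.enterShrink, h.east]
  · cases h
    simpa using (Grow.shape hq).1

theorem growSeries_upper (b : Bool) (d : ℕ) : growSeries (upper b) d =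
    growSeries (entered b) (d + 1) + growSeries (upper b) (d + 1) := by
  refine genSeries_eq_add (injective_append_left [E, N]) (injective_append_left [E])
    (growSet_finite _ _) (fun a p m => ?_) fun a p m q _ r hr h => ?_
  · ext ⟨L, R⟩
    constructor
    · intro h
      cases h with
      | indent h => exact .inl ⟨(_, _), h, rfl⟩
      | eastUpper h => exact .inr ⟨(_, _), h, rfl⟩
    · rintro (⟨_, h, ⟨⟩⟩ | ⟨_, h, ⟨⟩⟩)
      exacts [h.indent, h.eastUpper]
  · have tail : N :: q.1 = r.1 := List.tail_eq_of_cons_eq (congrArg Prod.fst h)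
    simpa [← tail] using (Grow.shape hr).1

theorem growSeries_lower (b : Bool) (d : ℕ) : growSeries (lower b) d =
    growSeries (upper b) (d + 1) + growSeries (lower b) (d + 1) := by
  refine genSeries_eq_add (injective_append_left [E, S]) (injective_append_left [E])
    (growSet_finite _ _) (fun a p m => ?_) fun a p m q _ r hr h => ?_
  · ext ⟨L, R⟩
    constructor
    · intro h
      cases h with
      | descend h => exact .inl ⟨(_, _), h, rfl⟩
      | eastLower h => exact .inr ⟨(_, _), h, rfl⟩
    · rintro (⟨_, h, ⟨⟩⟩ | ⟨_, h, ⟨⟩⟩)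
      exacts [h.descend, h.eastLower]
  · have tail : S :: q.1 = r.1 := List.tail_eq_of_cons_eq (congrArg Prod.fst h)
    simpa [← tail] using (Grow.shape hr).1

theorem growSeries_raised (b : Bool) (d : ℕ) : growSeries (raised b) d =
    C y * growSeries (entered b) d + X * growSeries (lower b) d := by
  simp only [growSeries, C_y_mul_genSeries, X_mul_genSeries]
  refine genSeries_eq_add (injective_append_left [N]) (injective_append_left [N])
    (growSet_finite _ _) (fun a p m => ?_) ?_
  · ext ⟨L, R⟩
    constructor
    · intro h
      cases h with
      | raise h => exact .inl ⟨(_, _), ⟨_, rfl, h⟩, rfl⟩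
      | raiseIndent h => exact .inr ⟨(_, _), ⟨_, rfl, h⟩, rfl⟩
    · rintro (⟨_, ⟨_, rfl, h⟩, ⟨⟩⟩ | ⟨_, ⟨_, rfl, h⟩, ⟨⟩⟩)
      exacts [h.raise, h.raiseIndent]
  · rintro a p m q ⟨_, -, hq⟩ r ⟨_, -, hr⟩ h
    obtain rfl := injective_append_left [N] h
    simpa [(Grow.shape hr).2.1] using (Grow.shape hq).1

theorem growSeries_shrinking (d : ℕ) : growSeries shrinking d =
    growSeries shrinking (d + 1) + growSeries (raised false) (d + 1) +
      growSeries (raised true) d := by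
  have moved : genSeries (fun a p m => growSet shrinking (d + 1) a p m ∪
      growSet (raised false) (d + 1) a p m) =
        growSeries shrinking (d + 1) + growSeries (raised false) (d + 1) := by
    refine genSeries_eq_add Function.injective_id Function.injective_id
      (fun a p m => (growSet_finite _ _ _ _ _).union (growSet_finite _ _ _ _ _))
      (fun a p m => by simp only [Set.image_id]) fun a p m q hq r hr h => ?_
    obtain rfl : q = r := h
    simpa [(Grow.shape hq).2] using (Grow.shape hr).2.2
  rw [← moved]
  refine genSeries_eq_add (injective_append_right [E]) Function.injective_id (growSet_finite _ _)
    (fun a p m => ?_) fun a p m q _ r hr h => ?_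
  · ext ⟨L, R⟩
    constructor
    · intro h
      cases h with
      | @shrink _ _ _ _ _ R h => exact .inl ⟨(L, R), .inl h, rfl⟩
      | @turn _ _ _ _ _ R h => exact .inl ⟨(L, R), .inr h, rfl⟩
      | keep h => exact .inr ⟨(_, _), h, rfl⟩
    · rintro (⟨_, h | h, ⟨⟩⟩ | ⟨_, h, ⟨⟩⟩)
      exacts [h.shrink, h.turn, h.keep]
  · obtain rfl : _ = r := h
    simpa using (Grow.shape hr).2.1

theorem rowSystem_widening : RowSystem (C y) X (fun d => growSeries widening (d + 1))
    (growSeries (entered false)) (growSeries (upper false)) (growSeries (lower false))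
    (growSeries (raised false)) where
  entered := growSeries_entered_false
  upper := growSeries_upper false
  lower := growSeries_lower false
  raised := growSeries_raised false
  entered_mem := growSeries_mem _
  upper_mem := growSeries_mem _
  lower_mem := growSeries_mem _

theorem rowSystem_shrinking : RowSystem (C y) X (growSeries shrinking)
    (growSeries (entered true)) (growSeries (upper true)) (growSeries (lower true))
    (growSeries (raised true)) where
  entered := growSeries_entered_true
  upper := growSeries_upper true
  lower := growSeries_lower true
  raised := growSeries_raised true
  entered_mem := growSeries_mem _
  upper_mem := growSeries_mem _
  lower_mem := growSeries_mem _

theorem growSeries_staircase_equation :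
    growSeries (entered false) 0 * (1 - C x - rise (C y) X (growSeries (entered false) 0) -
      rise (C y) X (growSeries (entered false) 0) * growSeries (entered false) 0) = C x :=
  rowSystem_widening.staircase_equation (C_mem_maximalIdeal x_mem_maximalIdeal)
    (C_mem_maximalIdeal y_mem_maximalIdeal) X_mem_maximalIdeal growSeries_widening_zero
    growSeries_widening_succ

theorem growSeries_unimodal_equation :
    (growSeries (entered false) 0 + growSeries (entered true) 0) *
      (1 - C x - rise (C y) X (growSeries (entered false) 0) -
        2 * rise (C y) X (growSeries (entered false) 0) * growSeries (entered false) 0) = C x :=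
  rowSystem_widening.unimodal_equation rowSystem_shrinking (C_mem_maximalIdeal x_mem_maximalIdeal)
    (C_mem_maximalIdeal y_mem_maximalIdeal) X_mem_maximalIdeal growSeries_widening_zero
    growSeries_widening_succ (growSeries_mem _) growSeries_shrinking

theorem transport_growSeries_entered :
    transportDeriv (MvPowerSeries.pderiv ℚ (1 : Fin 2)) (growSeries (entered false) 0 ^ 2)
      (growSeries (entered false) 0) = 0 :=
  transport_of_staircase_equation _ x_mem_maximalIdeal y_mem_maximalIdeal pderiv_x pderiv_y
    growSeries_staircase_equation

theorem coeff_growSeries_staircase (m : ℕ) :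
    coeff (m + 1) (growSeries (entered false) 0) =
      MvPowerSeries.C (1 / ((m + 1).factorial : ℚ)) * dy^[m] (I ^ (m + 1) * dy (divY SP)) :=
  coeff_eq_of_transport transport_growSeries_entered transport_growSeries_entered
    (constantCoeff_eq_divY_SP growSeries_staircase_equation)
    (constantCoeff_eq_divY_SP growSeries_staircase_equation) m

theorem coeff_growSeries_unimodal (m : ℕ) :
    coeff (m + 1) (growSeries (entered false) 0 + growSeries (entered true) 0) =
      MvPowerSeries.C (1 / ((m + 1).factorial : ℚ)) * dy^[m] (I ^ (m + 1) * dy (divY UP)) :=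
  coeff_eq_of_transport transport_growSeries_entered
    (transport_of_unimodal_equation _ x_mem_maximalIdeal y_mem_maximalIdeal pderiv_x pderiv_y
      transport_growSeries_entered growSeries_unimodal_equation)
    (constantCoeff_eq_divY_SP growSeries_staircase_equation)
    (constantCoeff_eq_divY_UP (constantCoeff_eq_divY_SP growSeries_staircase_equation)
      growSeries_unimodal_equation) m

end Grow

section Displacement

/-- The horizontal displacement of a walk. -/
def xdisp (w : List Step) : ℤ := (w.map fun s => s.vec.1).sum

/-- The vertical displacement of a walk. -/
def ydisp (w : List Step) : ℤ := (w.map fun s => s.vec.2).sum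

variable (u v w : List Step)

@[simp] theorem xdisp_nil : xdisp [] = 0 := rfl

@[simp] theorem ydisp_nil : ydisp [] = 0 := rfl

@[simp] theorem xdisp_append : xdisp (u ++ v) = xdisp u + xdisp v := by simp [xdisp]

@[simp] theorem ydisp_append : ydisp (u ++ v) = ydisp u + ydisp v := by simp [ydisp]

@[simp] theorem xdisp_reverse : xdisp w.reverse = xdisp w := by
  simp [xdisp, List.map_reverse, List.sum_reverse]

@[simp] theorem ydisp_reverse : ydisp w.reverse = ydisp w := by
  simp [ydisp, List.map_reverse, List.sum_reverse]

@[simp] theorem xdisp_N : xdisp (N :: w) = xdisp w := by simp [xdisp, Step.vec]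

@[simp] theorem xdisp_S : xdisp (S :: w) = xdisp w := by simp [xdisp, Step.vec]

@[simp] theorem xdisp_E : xdisp (E :: w) = xdisp w + 1 := by simp [xdisp, Step.vec, add_comm]

@[simp] theorem xdisp_W : xdisp (W :: w) = xdisp w - 1 := by
  simp [xdisp, Step.vec, sub_eq_neg_add]

@[simp] theorem ydisp_N : ydisp (N :: w) = ydisp w + 1 := by simp [ydisp, Step.vec, add_comm]

@[simp] theorem ydisp_S : ydisp (S :: w) = ydisp w - 1 := by
  simp [ydisp, Step.vec, sub_eq_neg_add]

@[simp] theorem ydisp_E : ydisp (E :: w) = ydisp w := by simp [ydisp, Step.vec]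

@[simp] theorem ydisp_W : ydisp (W :: w) = ydisp w := by simp [ydisp, Step.vec]

theorem pos_eq (k : ℕ) : pos w k = (xdisp (w.take k), ydisp (w.take k)) := by
  rw [pos]
  induction w.take k with
  | nil => rfl
  | cons s l ih =>
    rw [List.map_cons, List.sum_cons, ih]
    rfl

theorem pos_append_length : pos (u ++ v) u.length = (xdisp u, ydisp u) := by
  rw [pos_eq, List.take_left]

end Displacement

/-- The height of the end of the left edge above the top of the completed rows. -/
def Stage.leftLift : Stage → ℕ
  | upper _ => 1
  | _ => 0

/-- The number of rows that the right boundary, but not yet the left edge, has passed. -/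
def Stage.rightLead : Stage → ℕ
  | entered _ | upper _ | lower _ => 1
  | _ => 0

/-- The number of vertical steps of the left edge in the current, unfinished indent. -/
def Stage.detour : Stage → ℕ
  | upper _ => 1
  | lower _ => 2
  | _ => 0

/-- The number, zero or one, of unfinished indents. -/
def Stage.openIndents : Stage → ℕ
  | upper _ | lower _ => 1
  | _ => 0

/-- Whether the right boundary has begun to move to the left. -/
def Stage.turned : Stage → Bool
  | widening => false
  | shrinking => true
  | entered b | upper b | lower b | raised b => b

namespace Grow

variable {s : Stage} {d a p m : ℕ} {L R : List Step}

theorem gap (h : Grow s d a p m L R) : -xdisp R = xdisp L + d + s.offset := by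
  induction h <;> simp only [Stage.offset, xdisp_nil, xdisp_N, xdisp_S, xdisp_E, xdisp_W] at * <;>
    omega

theorem ydisp_left (h : Grow s d a p m L R) : ydisp L = p + m + 1 + s.leftLift := by
  induction h <;> simp only [Stage.leftLift, ydisp_nil, ydisp_N, ydisp_S, ydisp_E] at * <;> omega

theorem ydisp_right (h : Grow s d a p m L R) : -ydisp R = p + m + s.rightLead := by
  induction h <;> simp only [Stage.rightLead, ydisp_nil, ydisp_S, ydisp_E, ydisp_W] at * <;> omega

theorem length_left (h : Grow s d a p m L R) :
    (L.length : ℤ) = xdisp L + p + 3 * m + 1 + s.detour := by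
  induction h <;>
    simp only [Stage.detour, xdisp_nil, xdisp_N, xdisp_S, xdisp_E, List.length_cons,
      List.length_nil] at * <;> omega

theorem length_right (h : Grow s d a p m L R) :
    (R.length : ℤ) = 2 * a + xdisp R - ydisp R := by
  induction h with
  | base => rfl
  | widen _ ih | enterWide _ ih | enterShrink _ ih | turn _ ih | shrink _ ih =>
    simp only [xdisp_S, ydisp_S, xdisp_E, ydisp_E, xdisp_W, ydisp_W, List.length_cons]
    omega
  | _ => assumption

theorem count_E_left (h : Grow s d a p m L R) : (L.count E : ℤ) = xdisp L := by
  induction h <;> simp_all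

theorem count_E_right (h : Grow s d a p m L R) : (R.count E : ℤ) = a + xdisp R := by
  induction h <;> simp_all <;> omega

theorem neg_xdisp_right_of_not_turned (h : Grow s d a p m L R) (hs : s.turned = false) :
    -xdisp R = a := by
  induction h with
  | widen _ ih =>
    have := ih rfl
    rw [xdisp_W]
    omega
  | _ => simp_all [Stage.turned]

theorem N_notMem_right (h : Grow s d a p m L R) : N ∉ R := by
  induction h <;> simp_all

theorem exists_left_eq_append_N (h : Grow s d a p m L R) : ∃ L', L = L' ++ [N] := by
  induction h with
  | base => exact ⟨[], rfl⟩
  | indent _ ih | descend _ ih =>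
    obtain ⟨L', rfl⟩ := ih
    exact ⟨_ :: _ :: L', rfl⟩
  | east _ ih | eastUpper _ ih | eastLower _ ih | raise _ ih | raiseIndent _ ih =>
    obtain ⟨L', rfl⟩ := ih
    exact ⟨_ :: L', rfl⟩
  | _ => assumption

theorem exists_suffix_neg_xdisp_eq_width (h : Grow s d a p m L R) :
    ∃ r, r <:+ R ∧ -xdisp r = a := by
  induction h with
  | base => exact ⟨[], List.suffix_rfl, rfl⟩
  | widen h _ => exact ⟨_, List.suffix_rfl, h.widen.neg_xdisp_right_of_not_turned rfl⟩
  | enterWide _ ih | enterShrink _ ih | shrink _ ih | turn _ ih =>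
    obtain ⟨r, hr, hx⟩ := ih
    exact ⟨r, hr.trans (List.suffix_cons _ _), hx⟩
  | _ => assumption

end Grow

section Separated

/-- A walk, given from its end to its start or conversely, that visits no vertex twice. -/
def SelfAvoiding (w : List Step) : Prop :=
  ∀ u v, v ++ u <:+ w → v ≠ [] → xdisp v = 0 → ydisp v ≠ 0

theorem selfAvoiding_nil : SelfAvoiding [] := fun _ _ h hv =>
  absurd (List.append_eq_nil_iff.1 (List.suffix_nil.1 h)).1 hv

theorem SelfAvoiding.cons {s : Step} {w : List Step} (h : SelfAvoiding w)
    (hs : ∀ u, u <:+ w → xdisp u = xdisp (s :: w) → ydisp u ≠ ydisp (s :: w)) :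
    SelfAvoiding (s :: w) := by
  intro u v hu hv hx hy
  rcases List.suffix_cons_iff.1 hu with hu | hu
  · obtain ⟨c, v, rfl⟩ := List.exists_cons_of_ne_nil hv
    refine hs u ⟨v, (List.cons.inj hu).2⟩ ?_ ?_
    · rw [← hu, xdisp_append, hx, zero_add]
    · rw [← hu, ydisp_append, hy, zero_add]
  · exact h u v hu hv hx hy

/-- The reversed left edge `L`, which starts at the origin, and the right boundary `R`, which ends
at the origin, are self-avoiding and disjoint. They lie in a box of width `a`, and `L` stays below
height `t` and to the left of its last vertex. -/
structure Separated (L R : List Step) (a t : ℤ) : Prop where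
  left : ∀ l, l <:+ L → 0 ≤ xdisp l ∧ xdisp l ≤ xdisp L ∧ 0 ≤ ydisp l ∧ ydisp l ≤ t
  right : ∀ r, r <:+ R → 0 ≤ -xdisp r ∧ -xdisp r ≤ a ∧ 0 ≤ -ydisp r ∧ -ydisp r ≤ -ydisp R
  selfAvoiding_left : SelfAvoiding L
  selfAvoiding_right : SelfAvoiding R
  disjoint : ∀ l r, l <:+ L → r <:+ R → xdisp l = -xdisp r → ydisp l = -ydisp r → l = [] ∧ r = []

namespace Separated

variable {L R : List Step} {a t : ℤ}

theorem cons_left (h : Separated L R a t) (s : Step) {t' : ℤ} (ht : t ≤ t')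
    (hx : xdisp L ≤ xdisp (s :: L)) (hy : 0 ≤ ydisp (s :: L) ∧ ydisp (s :: L) ≤ t')
    (hl : ∀ l, l <:+ L → xdisp l = xdisp (s :: L) → ydisp l ≠ ydisp (s :: L))
    (hr : ∀ r, r <:+ R → xdisp (s :: L) = -xdisp r → ydisp (s :: L) ≠ -ydisp r) :
    Separated (s :: L) R a t' where
  left l hl := by
    rcases List.suffix_cons_iff.1 hl with rfl | hl
    · have := h.left L List.suffix_rfl
      omega
    · have := h.left l hl
      omega
  right := h.right
  selfAvoiding_left := h.selfAvoiding_left.cons hl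
  selfAvoiding_right := h.selfAvoiding_right
  disjoint l r hl' hr' hx hy := by
    rcases List.suffix_cons_iff.1 hl' with rfl | hl'
    · exact absurd hy (hr r hr' hx)
    · exact h.disjoint l r hl' hr' hx hy

theorem cons_right (h : Separated L R a t) (s : Step) {a' : ℤ} (ha : a ≤ a')
    (hx : 0 ≤ -xdisp (s :: R) ∧ -xdisp (s :: R) ≤ a') (hy : -ydisp R ≤ -ydisp (s :: R))
    (hr : ∀ r, r <:+ R → xdisp r = xdisp (s :: R) → ydisp r ≠ ydisp (s :: R))
    (hl : ∀ l, l <:+ L → xdisp l ≠ -xdisp (s :: R)) : Separated L (s :: R) a' t where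
  left := h.left
  right r hr := by
    rcases List.suffix_cons_iff.1 hr with rfl | hr
    · have := h.right R List.suffix_rfl
      omega
    · have := h.right r hr
      omega
  selfAvoiding_left := h.selfAvoiding_left
  selfAvoiding_right := h.selfAvoiding_right.cons hr
  disjoint l r hl' hr' hx hy := by
    rcases List.suffix_cons_iff.1 hr' with rfl | hr'
    · exact absurd hx (hl l hl')
    · exact h.disjoint l r hl' hr' hx hy

theorem cons_left_E (h : Separated L R a t)
    (hR : ∀ r, r <:+ R → xdisp L + 1 = -xdisp r → ydisp L ≠ -ydisp r) :
    Separated (E :: L) R a t := by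
  refine h.cons_left E le_rfl (by simp) (by simpa using (h.left L List.suffix_rfl).2.2)
    (fun l hl hx => ?_) (by simpa using hR)
  have := h.left l hl
  rw [xdisp_E] at hx
  omega

theorem eq_cons_E_of_xdisp_eq (h : Separated L R a t) {l : List Step} (hl : l <:+ E :: L)
    (hx : xdisp l = xdisp (E :: L)) : l = E :: L := by
  rcases List.suffix_cons_iff.1 hl with rfl | hl
  · rfl
  · have := h.left l hl
    rw [xdisp_E] at hx
    omega

theorem eq_cons_S_of_ydisp_eq (h : Separated L R a t) {r : List Step} (hr : r <:+ S :: R)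
    (hy : ydisp r = ydisp (S :: R)) : r = S :: R := by
  rcases List.suffix_cons_iff.1 hr with rfl | hr
  · rfl
  · have := h.right r hr
    rw [ydisp_S] at hy
    omega

theorem cons_left_N (h : Separated L R a t) {t' : ℤ} (ht : t ≤ t') (hL : ydisp L < t')
    (hl : ∀ l, l <:+ L → xdisp l = xdisp L → ydisp l ≤ ydisp L) (hR : -ydisp R ≤ ydisp L) :
    Separated (N :: L) R a t' := by
  have tip := h.left L List.suffix_rfl
  refine h.cons_left N ht (by simp) (by rw [ydisp_N]; omega) (fun l hl' hx => ?_)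
    fun r hr _ => ?_
  · have := hl l hl' (by simpa using hx)
    rw [ydisp_N]
    omega
  · have := h.right r hr
    rw [ydisp_N]
    omega

theorem cons_right_E (h : Separated L R a t) (hR : xdisp L < -xdisp R - 1)
    (hr : ∀ r, r <:+ R → ydisp r = ydisp R → xdisp r ≤ xdisp R) : Separated L (E :: R) a t := by
  have tip := h.right R List.suffix_rfl
  have left_tip := h.left L List.suffix_rfl
  refine h.cons_right E le_rfl (by rw [xdisp_E]; omega) (by simp) (fun r hr' hx hy => ?_)
    fun l hl => ?_
  · have := hr r hr' (by simpa using hy)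
    rw [xdisp_E] at hx
    omega
  · have := h.left l hl
    rw [xdisp_E]
    omega

theorem cons_right_S (h : Separated L R a t) (hR : xdisp L < -xdisp R) :
    Separated L (S :: R) a t := by
  have tip := h.right R List.suffix_rfl
  refine h.cons_right S le_rfl (by rw [xdisp_S]; omega) (by simp) (fun r hr _ => ?_)
    fun l hl => ?_
  · have := h.right r hr
    rw [ydisp_S]
    omega
  · have := h.left l hl
    rw [xdisp_S]
    omega

theorem cons_right_W (h : Separated L R a t) (hR : -xdisp R = a) (hL : xdisp L ≤ -xdisp R) :
    Separated L (W :: R) (a + 1) t := by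
  have tip := h.right R List.suffix_rfl
  refine h.cons_right W (by omega) (by rw [xdisp_W]; omega) (by simp) (fun r hr hx => ?_)
    fun l hl => ?_
  · have := h.right r hr
    rw [xdisp_W] at hx
    omega
  · have := h.left l hl
    rw [xdisp_W]
    omega

end Separated

theorem separated_N_nil : Separated [N] [] 0 1 where
  left l hl := by
    rcases List.suffix_cons_iff.1 hl with rfl | hl
    · simp
    · simp [List.suffix_nil.1 hl]
  right r hr := by simp [List.suffix_nil.1 hr]
  selfAvoiding_left := selfAvoiding_nil.cons fun u hu => by simp [List.suffix_nil.1 hu]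
  selfAvoiding_right := selfAvoiding_nil
  disjoint l r hl hr := by
    rw [List.suffix_nil.1 hr]
    rcases List.suffix_cons_iff.1 hl with rfl | hl
    · simp
    · simp [List.suffix_nil.1 hl]

end Separated

/-- The two walks of the construction are separated, and no earlier vertex of the walks obstructs
the next step. -/
structure Grow.Geometry (s : Stage) (a p m : ℕ) (L R : List Step) : Prop where
  separated : Separated L R a (p + m + 1 + s.openIndents)
  left_tip : s.openIndents = 1 → ∀ l, l <:+ L → xdisp l = xdisp L → l = L
  right_tip : s ≠ widening → s ≠ shrinking → ∀ r, r <:+ R → ydisp r = ydisp R → r = R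
  last_row : s = shrinking → ∀ r, r <:+ R → ydisp r = ydisp R → xdisp r ≤ xdisp R

namespace Grow.Geometry

variable {b : Bool} {d a p m : ℕ} {L R : List Step}

theorem base : Geometry widening 0 0 0 [N] [] :=
  ⟨by simpa [Stage.openIndents] using separated_N_nil, nofun, nofun, nofun⟩

theorem widen (g : Geometry widening a p m L R) (h : Grow widening d a p m L R) :
    Geometry widening (a + 1) p m L (W :: R) := by
  have gap : -xdisp R = xdisp L + d + 0 := h.gap
  refine ⟨?_, nofun, nofun, nofun⟩
  rw [Nat.cast_succ]
  exact g.separated.cons_right_W (h.neg_xdisp_right_of_not_turned rfl) (by omega)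

theorem settle (g : Geometry (raised false) a p m L R) : Geometry widening a p m L R :=
  ⟨g.separated, nofun, nofun, nofun⟩

theorem keep (g : Geometry (raised true) a p m L R) : Geometry shrinking a p m L R :=
  ⟨g.separated, nofun, nofun, fun _ r hr hy => by rw [g.right_tip nofun nofun r hr hy]⟩

theorem enterWide (g : Geometry widening a p m L R) (h : Grow widening (d + 1) a p m L R) :
    Geometry (entered false) a p m L (S :: R) := by
  have gap : -xdisp R = xdisp L + (d + 1 : ℕ) + 0 := h.gap
  exact ⟨g.separated.cons_right_S (by omega), nofun,
    fun _ _ _ => g.separated.eq_cons_S_of_ydisp_eq, nofun⟩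

theorem enterShrink (g : Geometry shrinking a p m L R) (h : Grow shrinking d a p m L R) :
    Geometry (entered true) a p m L (S :: R) := by
  have gap : -xdisp R = xdisp L + d + 1 := h.gap
  exact ⟨g.separated.cons_right_S (by omega), nofun,
    fun _ _ _ => g.separated.eq_cons_S_of_ydisp_eq, nofun⟩

theorem east (g : Geometry (entered b) a p m L R) (h : Grow (entered b) (d + 1) a p m L R) :
    Geometry (entered b) a p m (E :: L) R := by
  have gap : -xdisp R = xdisp L + (d + 1 : ℕ) + 1 := h.gap
  have left_height : ydisp L = p + m + 1 + 0 := h.ydisp_left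
  have right_height : -ydisp R = p + m + 1 := h.ydisp_right
  refine ⟨g.separated.cons_left_E fun r hr hx hy => ?_, nofun,
    fun _ _ => g.right_tip nofun nofun, nofun⟩
  obtain rfl := g.right_tip nofun nofun r hr (by omega)
  omega

theorem eastUpper (g : Geometry (upper b) a p m L R) (h : Grow (upper b) (d + 1) a p m L R) :
    Geometry (upper b) a p m (E :: L) R := by
  have left_height : ydisp L = p + m + 1 + 1 := h.ydisp_left
  have right_height : -ydisp R = p + m + 1 := h.ydisp_right
  refine ⟨g.separated.cons_left_E fun r hr _ hy => ?_,
    fun _ _ => g.separated.eq_cons_E_of_xdisp_eq, fun _ _ => g.right_tip nofun nofun, nofun⟩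
  have := g.separated.right r hr
  omega

theorem eastLower (g : Geometry (lower b) a p m L R) (h : Grow (lower b) (d + 1) a p m L R) :
    Geometry (lower b) a p m (E :: L) R := by
  have gap : -xdisp R = xdisp L + (d + 1 : ℕ) + 1 := h.gap
  have left_height : ydisp L = p + m + 1 + 0 := h.ydisp_left
  have right_height : -ydisp R = p + m + 1 := h.ydisp_right
  refine ⟨g.separated.cons_left_E fun r hr hx hy => ?_,
    fun _ _ => g.separated.eq_cons_E_of_xdisp_eq, fun _ _ => g.right_tip nofun nofun, nofun⟩
  obtain rfl := g.right_tip nofun nofun r hr (by omega)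
  omega

theorem indent (g : Geometry (entered b) a p m L R) (h : Grow (entered b) (d + 1) a p m L R) :
    Geometry (upper b) a p m (E :: N :: L) R := by
  have left_height : ydisp L = p + m + 1 + 0 := h.ydisp_left
  have right_height : -ydisp R = p + m + 1 := h.ydisp_right
  have top : ∀ l, l <:+ L → ydisp l ≤ p + m + 1 + 0 := fun l hl => (g.separated.left l hl).2.2.2
  have risen : Separated (N :: L) R a (p + m + 1 + (upper b).openIndents) :=
    g.separated.cons_left_N (by simp [Stage.openIndents]) (by simp [Stage.openIndents]; omega)
      (fun l hl _ => by have := top l hl; omega) (by omega)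
  refine ⟨risen.cons_left_E fun r hr _ => ?_, fun _ _ => risen.eq_cons_E_of_xdisp_eq,
    fun _ _ => g.right_tip nofun nofun, nofun⟩
  have := g.separated.right r hr
  rw [ydisp_N]
  omega

theorem descend (g : Geometry (upper b) a p m L R) (h : Grow (upper b) (d + 1) a p m L R) :
    Geometry (lower b) a p m (E :: S :: L) R := by
  have gap : -xdisp R = xdisp L + (d + 1 : ℕ) + 1 := h.gap
  have left_height : ydisp L = p + m + 1 + 1 := h.ydisp_left
  have right_height : -ydisp R = p + m + 1 := h.ydisp_right
  have fallen : Separated (S :: L) R a (p + m + 1 + (lower b).openIndents) := by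
    refine g.separated.cons_left S le_rfl (by simp) (by simp [Stage.openIndents]; omega)
      (fun l hl hx => ?_) fun r hr hx hy => ?_
    · rw [g.left_tip rfl l hl (by simpa using hx), ydisp_S]
      omega
    · rw [ydisp_S] at hy
      rw [xdisp_S] at hx
      obtain rfl := g.right_tip nofun nofun r hr (by omega)
      omega
  refine ⟨fallen.cons_left_E fun r hr hx hy => ?_, fun _ _ => fallen.eq_cons_E_of_xdisp_eq,
    fun _ _ => g.right_tip nofun nofun, nofun⟩
  rw [ydisp_S] at hy
  rw [xdisp_S] at hx
  obtain rfl := g.right_tip nofun nofun r hr (by omega)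
  omega

theorem raise (g : Geometry (entered b) a p m L R) (h : Grow (entered b) d a p m L R) :
    Geometry (raised b) a (p + 1) m (N :: L) R := by
  have left_height : ydisp L = p + m + 1 + 0 := h.ydisp_left
  have right_height : -ydisp R = p + m + 1 := h.ydisp_right
  have top : ∀ l, l <:+ L → ydisp l ≤ p + m + 1 + 0 := fun l hl => (g.separated.left l hl).2.2.2
  exact ⟨g.separated.cons_left_N (by simp [Stage.openIndents]) (by simp [Stage.openIndents]; omega)
      (fun l hl _ => by have := top l hl; omega) (by omega), nofun,
    fun _ _ => g.right_tip nofun nofun, nofun⟩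

theorem raiseIndent (g : Geometry (lower b) a p m L R) (h : Grow (lower b) d a p m L R) :
    Geometry (raised b) a p (m + 1) (N :: L) R := by
  have left_height : ydisp L = p + m + 1 + 0 := h.ydisp_left
  have right_height : -ydisp R = p + m + 1 := h.ydisp_right
  exact ⟨g.separated.cons_left_N (by simp [Stage.openIndents]) (by simp [Stage.openIndents]; omega)
      (fun l hl hx => by rw [g.left_tip rfl l hl hx]) (by omega), nofun,
    fun _ _ => g.right_tip nofun nofun, nofun⟩

theorem xdisp_le_xdisp_cons_E (hR : ∀ r, r <:+ R → ydisp r = ydisp R → xdisp r ≤ xdisp R)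
    (r : List Step) (hr : r <:+ E :: R) (hy : ydisp r = ydisp (E :: R)) :
    xdisp r ≤ xdisp (E :: R) := by
  rcases List.suffix_cons_iff.1 hr with rfl | hr
  · rfl
  · have := hR r hr (by simpa using hy)
    rw [xdisp_E]
    omega

theorem turn (g : Geometry (raised false) a p m L R) (h : Grow (raised false) (d + 1) a p m L R) :
    Geometry shrinking a p m L (E :: R) := by
  have gap : -xdisp R = xdisp L + (d + 1 : ℕ) + 1 := h.gap
  have last_row : ∀ r, r <:+ R → ydisp r = ydisp R → xdisp r ≤ xdisp R :=
    fun r hr hy => by rw [g.right_tip nofun nofun r hr hy]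
  exact ⟨g.separated.cons_right_E (by omega) last_row, nofun, nofun,
    fun _ => xdisp_le_xdisp_cons_E last_row⟩

theorem shrink (g : Geometry shrinking a p m L R) (h : Grow shrinking (d + 1) a p m L R) :
    Geometry shrinking a p m L (E :: R) := by
  have gap : -xdisp R = xdisp L + (d + 1 : ℕ) + 1 := h.gap
  exact ⟨g.separated.cons_right_E (by omega) (g.last_row rfl), nofun, nofun,
    fun _ => xdisp_le_xdisp_cons_E (g.last_row rfl)⟩

end Grow.Geometry

theorem Grow.geometry {s : Stage} {d a p m : ℕ} {L R : List Step} (h : Grow s d a p m L R) :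
    Grow.Geometry s a p m L R := by
  induction h with
  | base => exact .base
  | widen h ih => exact ih.widen h
  | settle _ ih => exact ih.settle
  | enterWide h ih => exact ih.enterWide h
  | enterShrink h ih => exact ih.enterShrink h
  | east h ih => exact ih.east h
  | indent h ih => exact ih.indent h
  | eastUpper h ih => exact ih.eastUpper h
  | descend h ih => exact ih.descend h
  | eastLower h ih => exact ih.eastLower h
  | raise h ih => exact ih.raise h
  | raiseIndent h ih => exact ih.raiseIndent h
  | turn h ih => exact ih.turn h
  | shrink h ih => exact ih.shrink h
  | keep _ ih => exact ih.keep

/-- The indents of the reversed left edge `L` start at distinct heights, increasing along the edge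
and at most `t`, and there is a rise between any two of them. -/
structure IndentsApart (L : List Step) (t : ℤ) : Prop where
  pair : ∀ v l, S :: (v ++ S :: l) <:+ L → ydisp l < ydisp (v ++ S :: l) ∧ N ∈ v
  height_le : ∀ l, S :: l <:+ L → ydisp l ≤ t

namespace IndentsApart

variable {L : List Step} {t t' : ℤ}

theorem cons {c : Step} (h : IndentsApart L t) (hc : c ≠ S) (ht : t ≤ t') :
    IndentsApart (c :: L) t' where
  pair v l hl := h.pair v l (by simpa [List.suffix_cons_iff, hc.symm] using hl)
  height_le l hl := (h.height_le l (by simpa [List.suffix_cons_iff, hc.symm] using hl)).trans ht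

theorem cons_S (h : IndentsApart L t) (hL : t < ydisp L) (ht : ydisp L ≤ t')
    (hN : ∀ v l, L = v ++ S :: l → N ∈ v) : IndentsApart (S :: L) t' where
  pair v l hl := by
    rcases List.suffix_cons_iff.1 hl with hl | hl
    · obtain rfl := (List.cons.inj hl).2
      exact ⟨(h.height_le l (List.suffix_append _ _)).trans_lt hL, hN v l rfl⟩
    · exact h.pair v l hl
  height_le l hl := by
    rcases List.suffix_cons_iff.1 hl with hl | hl
    · obtain rfl := (List.cons.inj hl).2
      exact ht
    · exact (h.height_le l hl).trans (hL.le.trans ht)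

end IndentsApart

section Indents

variable {s : Stage} {d a p m : ℕ} {L R : List Step}

theorem Grow.N_mem_of_left_eq (h : Grow s d a p m L R) (hs : s.detour ≠ 2) {v l : List Step}
    (hL : L = v ++ S :: l) : N ∈ v := by
  induction h generalizing v with
  | base => rcases v with _ | ⟨_, v⟩ <;> simp at hL
  | raise | raiseIndent =>
    rcases v with _ | ⟨_, v⟩
    · simp at hL
    · simp [← (List.cons.inj hL).1]
  | indent =>
    rcases v with _ | ⟨_, _ | ⟨_, v⟩⟩
    · simp at hL
    · simp at hL
    · simp [← (List.cons.inj (List.cons.inj hL).2).1]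
  | east _ ih | eastUpper _ ih =>
    rcases v with _ | ⟨_, v⟩
    · simp at hL
    · exact List.mem_cons_of_mem _ (ih hs (List.cons.inj hL).2)
  | descend | eastLower => exact absurd rfl hs
  | widen _ ih | settle _ ih | enterWide _ ih | enterShrink _ ih | turn _ ih | shrink _ ih
  | keep _ ih => exact ih hs hL

theorem Grow.indentsApart (h : Grow s d a p m L R) :
    IndentsApart L (p + m + 1 + (s.detour / 2 : ℕ)) := by
  induction h with
  | base =>
    exact ⟨fun _ _ h => by simpa using List.suffix_cons_iff.1 h,
      fun _ h => by simpa using List.suffix_cons_iff.1 h⟩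
  | east _ ih | eastUpper _ ih | eastLower _ ih => exact ih.cons nofun le_rfl
  | raise _ ih | raiseIndent _ ih =>
    exact ih.cons nofun (by simp only [Stage.detour]; omega)
  | @indent _ _ _ p m L _ _ ih =>
    have risen : IndentsApart (N :: L) (p + m + 1) := ih.cons nofun (by simp [Stage.detour])
    exact risen.cons nofun (by simp [Stage.detour])
  | descend h ih =>
    have height := h.ydisp_left
    simp only [Stage.leftLift] at height
    exact (ih.cons_S (by simp only [Stage.detour]; omega) (by simp only [Stage.detour]; omega)
      fun _ _ => h.N_mem_of_left_eq nofun).cons nofun le_rfl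
  | widen _ ih | settle _ ih | enterWide _ ih | enterShrink _ ih | turn _ ih | shrink _ ih
  | keep _ ih => exact ih

end Indents

section Lists

variable {α : Type*} {w : List α}

theorem exists_of_reverse_getElem? {i : ℕ} {c : α} (h : w.reverse[i]? = some c) :
    ∃ u v, w = u ++ c :: v ∧ v.length = i := by
  obtain ⟨hi, rfl⟩ := List.getElem?_eq_some_iff.1 h
  refine ⟨(w.reverse.drop (i + 1)).reverse, (w.reverse.take i).reverse, ?_, by simpa using hi.le⟩
  have split := congrArg List.reverse (List.take_append_drop i w.reverse)
  rw [List.drop_eq_getElem_cons hi, List.reverse_reverse] at split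
  simpa using split.symm

theorem exists_append_eq_of_length_lt {u u' : List α} (h : u <:+ w) (h' : u' <:+ w)
    (hl : u.length < u'.length) : ∃ v, v ≠ [] ∧ v ++ u = u' := by
  obtain ⟨v, rfl⟩ := List.suffix_of_suffix_length_le h h' hl.le
  exact ⟨v, by rintro rfl; exact lt_irrefl _ hl, rfl⟩

end Lists

section ClosedWalk

variable {L R : List Step}

theorem pos_left {u l : List Step} (hL : L = u ++ l) :
    pos (L.reverse ++ E :: R) l.length = (xdisp l, ydisp l) := by
  rw [hL, List.reverse_append, List.append_assoc, ← List.length_reverse (as := l),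
    pos_append_length, xdisp_reverse, ydisp_reverse]

theorem pos_top : pos (L.reverse ++ E :: R) (L.length + 1) = (xdisp L + 1, ydisp L) := by
  have := pos_append_length (E :: L).reverse R
  simpa using this

theorem pos_right (hx : xdisp (L.reverse ++ E :: R) = 0) (hy : ydisp (L.reverse ++ E :: R) = 0)
    {u r : List Step} (hR : R = u ++ r) :
    pos (L.reverse ++ E :: R) (L.length + 1 + u.length) = (-xdisp r, -ydisp r) := by
  have := pos_append_length (L.reverse ++ E :: u) r
  simp only [hR, List.append_assoc, List.cons_append, List.length_append, List.length_reverse,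
    List.length_cons, xdisp_append, ydisp_append, xdisp_E, ydisp_E] at this hx hy ⊢
  rw [show L.length + 1 + u.length = L.length + (u.length + 1) by omega, this, Prod.mk.injEq]
  omega

theorem exists_suffix_pos_eq (hx : xdisp (L.reverse ++ E :: R) = 0)
    (hy : ydisp (L.reverse ++ E :: R) = 0) {k : ℕ} (hk : k ≤ (L.reverse ++ E :: R).length) :
    (∃ l, l <:+ L ∧ l.length = k ∧ pos (L.reverse ++ E :: R) k = (xdisp l, ydisp l)) ∨
    ∃ r, r <:+ R ∧ k + r.length = L.length + R.length + 1 ∧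
      pos (L.reverse ++ E :: R) k = (-xdisp r, -ydisp r) := by
  rw [List.length_append, List.length_reverse, List.length_cons] at hk
  rcases Nat.lt_or_ge L.length k with hLk | hkL
  · obtain ⟨j, rfl⟩ := Nat.exists_eq_add_of_le hLk
    have hj : (R.take j).length = j := List.length_take_of_le (by omega)
    have hR := (List.take_append_drop j R).symm
    refine .inr ⟨R.drop j, List.drop_suffix _ _, by rw [List.length_drop]; omega, ?_⟩
    have := pos_right hx hy hR
    rwa [hj] at this
  · have hl : (L.drop (L.length - k)).length = k := by rw [List.length_drop]; omega
    have := pos_left (R := R) (List.take_append_drop (L.length - k) L).symm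
    rw [hl] at this
    exact .inl ⟨_, List.drop_suffix _ _, hl, this⟩

theorem Separated.pos_ne {a t : ℤ} (h : Separated L R a t)
    (hx : xdisp (L.reverse ++ E :: R) = 0) (hy : ydisp (L.reverse ++ E :: R) = 0) {i j : ℕ}
    (hij : i < j) (hj : j < (L.reverse ++ E :: R).length) :
    pos (L.reverse ++ E :: R) i ≠ pos (L.reverse ++ E :: R) j := by
  intro same
  have length_eq : (L.reverse ++ E :: R).length = L.length + R.length + 1 := by simp; omega
  rcases exists_suffix_pos_eq hx hy (hij.le.trans hj.le) with
    ⟨l, hl, hli, hi⟩ | ⟨r, hr, hri, hi⟩ <;>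
  rcases exists_suffix_pos_eq hx hy hj.le with
    ⟨l', hl', hlj, hj'⟩ | ⟨r', hr', hrj, hj'⟩ <;>
  rw [hi, hj', Prod.mk.injEq] at same
  · obtain ⟨v, hv, rfl⟩ := exists_append_eq_of_length_lt hl hl' (by omega)
    rw [xdisp_append, ydisp_append] at same
    exact h.selfAvoiding_left l v hl' hv (by omega) (by omega)
  · obtain ⟨rfl, rfl⟩ := h.disjoint l r' hl hr' same.1 same.2
    rw [List.length_nil] at hrj
    omega
  · have := hr.length_le
    have := hl'.length_le
    omega
  · obtain ⟨v, hv, rfl⟩ := exists_append_eq_of_length_lt hr' hr (by omega)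
    rw [xdisp_append, ydisp_append] at same
    exact h.selfAvoiding_right r' v hr hv (by omega) (by omega)

theorem exists_south_south {i j : ℕ} (hij : i < j) (hi : (L.reverse ++ E :: R)[i]? = some S)
    (hj : (L.reverse ++ E :: R)[j]? = some S) (hjL : j < L.length) :
    ∃ u v l, L = u ++ S :: (v ++ S :: l) ∧ l.length = i ∧ (v ++ S :: l).length = j := by
  rw [List.getElem?_append_left (by rw [List.length_reverse]; omega)] at hi hj
  obtain ⟨u, w, rfl, rfl⟩ := exists_of_reverse_getElem? hj
  have hi' : w.reverse[i]? = some S := by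
    rwa [List.reverse_append, List.reverse_cons, List.append_assoc,
      List.getElem?_append_left (by simpa using hij)] at hi
  obtain ⟨v, l, rfl, rfl⟩ := exists_of_reverse_getElem? hi'
  exact ⟨u, v, l, rfl, rfl, rfl⟩

theorem IndentsApart.depth_one {t : ℤ} {u v l : List Step} (h : IndentsApart L t)
    (hL : L = u ++ S :: (v ++ S :: l)) :
    ∃ k, l.length < k ∧ k < (v ++ S :: l).length ∧ (L.reverse ++ E :: R)[k]? = some N := by
  obtain ⟨v₁, v₂, rfl⟩ := List.append_of_mem (h.pair v l ⟨u, hL.symm⟩).2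
  refine ⟨(v₂ ++ S :: l).length, by simp; omega, by simp; omega, ?_⟩
  have hN : (L.reverse ++ E :: R) =
      (v₂ ++ S :: l).reverse ++ N :: ((u ++ S :: v₁).reverse ++ E :: R) := by simp [hL]
  rw [hN, ← List.length_reverse]
  simp

end ClosedWalk

namespace Grow

variable {c : Bool} {a p m : ℕ} {L R : List Step}

theorem closed (h : Grow (entered c) 0 a p m L R) :
    xdisp (L.reverse ++ E :: R) = 0 ∧ ydisp (L.reverse ++ E :: R) = 0 := by
  have gap : -xdisp R = xdisp L + 0 + 1 := h.gap
  have left : ydisp L = p + m + 1 + 0 := h.ydisp_left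
  have right : -ydisp R = p + m + 1 := h.ydisp_right
  rw [xdisp_append, ydisp_append, xdisp_reverse, ydisp_reverse, xdisp_E, ydisp_E]
  omega

theorem length_eq (h : Grow (entered c) 0 a p m L R) :
    (L.reverse ++ E :: R).length = 2 * (a + (p + m + 1)) + 2 * m := by
  have gap : -xdisp R = xdisp L + 0 + 1 := h.gap
  have right : -ydisp R = p + m + 1 := h.ydisp_right
  have left : (L.length : ℤ) = xdisp L + p + 3 * m + 1 + 0 := h.length_left
  have := h.length_right
  rw [List.length_append, List.length_reverse, List.length_cons]
  omega

theorem width_pos (h : Grow (entered c) 0 a p m L R) : 1 ≤ a := h.le_width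

theorem isPolygon (h : Grow (entered c) 0 a p m L R) : IsPolygon (L.reverse ++ E :: R) where
  length_ge := by
    have := h.width_pos
    rw [h.length_eq]
    omega
  closed := by
    rw [pos_eq, List.take_length, h.closed.1, h.closed.2]
    rfl
  simple _ _ := h.geometry.separated.pos_ne h.closed.1 h.closed.2

theorem pos_top (h : Grow (entered c) 0 a p m L R) :
    pos (L.reverse ++ E :: R) (L.length + 1) = (-xdisp R, ((p + m + 1 : ℕ) : ℤ)) := by
  have gap : -xdisp R = xdisp L + 0 + 1 := h.gap
  have left : ydisp L = p + m + 1 + 0 := h.ydisp_left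
  rw [MConvex.pos_top, Prod.mk.injEq]
  omega

theorem le_of_pos_top (h : Grow (entered c) 0 a p m L R) {k : ℕ}
    (hk : k ≤ (L.reverse ++ E :: R).length)
    (ht : (pos (L.reverse ++ E :: R) k).2 = (p + m + 1 : ℕ)) : k ≤ L.length + 1 := by
  rcases exists_suffix_pos_eq h.closed.1 h.closed.2 hk with ⟨l, hl, rfl, -⟩ | ⟨r, hr, hri, hp⟩
  · exact hl.length_le.trans (Nat.le_succ _)
  · have right : -ydisp R = p + m + 1 := h.ydisp_right
    rw [hp] at ht
    push_cast at ht
    obtain rfl := h.geometry.right_tip nofun nofun r hr (by omega)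
    omega

theorem onLeftEdge_iff (h : Grow (entered c) 0 a p m L R) (k : ℕ) :
    OnLeftEdge (p + m + 1) (L.reverse ++ E :: R) k ↔ k ≤ L.length := by
  constructor
  · rintro ⟨j, hkj, hj, ht⟩
    have := h.le_of_pos_top hj ht
    omega
  · exact fun hk => ⟨L.length + 1, by omega, by simp, by rw [h.pos_top]⟩

theorem hasBox (h : Grow (entered c) 0 a p m L R) :
    HasBox a (p + m + 1) (L.reverse ++ E :: R) where
  inside k hk := by
    have gap : -xdisp R = xdisp L + 0 + 1 := h.gap
    have height : -ydisp R = p + m + 1 := h.ydisp_right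
    have hR := h.geometry.separated.right R List.suffix_rfl
    push_cast
    rcases exists_suffix_pos_eq h.closed.1 h.closed.2 hk with ⟨l, hl, -, hp⟩ | ⟨r, hr, -, hp⟩ <;>
      rw [hp] <;> dsimp only
    · have hl : _ ∧ _ ∧ _ ∧ ydisp l ≤ p + m + 1 + 0 := h.geometry.separated.left l hl
      omega
    · have := h.geometry.separated.right r hr
      omega
  right := by
    obtain ⟨r, ⟨u, hR⟩, hr⟩ := h.exists_suffix_neg_xdisp_eq_width
    refine ⟨L.length + 1 + u.length, by simp [← hR]; omega, ?_⟩
    rw [pos_right h.closed.1 h.closed.2 hR.symm, hr]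
  top := ⟨L.length + 1, by simp, by rw [h.pos_top]⟩

theorem leftIndented (h : Grow (entered c) 0 a p m L R) :
    LeftIndented a (p + m + 1) (L.reverse ++ E :: R) := by
  have south_lt : ∀ {j : ℕ}, (L.reverse ++ E :: R)[j]? = some S →
      OnLeftEdge (p + m + 1) (L.reverse ++ E :: R) j → j < L.length := fun {j} hS hj =>
    ((h.onLeftEdge_iff j).1 hj).lt_of_ne (by rintro rfl; simp at hS)
  refine ⟨?_, fun k hk => ?_, fun i j hij hi hj hjL => ?_, fun i j hij hi hj hjL => ?_⟩
  · have gap : -xdisp R = xdisp L + 0 + 1 := h.gap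
    have := h.count_E_left
    have := h.count_E_right
    rw [List.count_append, List.count_reverse, List.count_cons_self]
    omega
  · rw [h.onLeftEdge_iff]
    by_contra hlt
    rw [List.getElem?_append_right (by rw [List.length_reverse]; omega)] at hk
    exact h.N_notMem_right (by simpa using List.mem_of_getElem? hk)
  · obtain ⟨u, v, l, hL, rfl, rfl⟩ := exists_south_south hij hi hj (south_lt hj hjL)
    exact h.indentsApart.depth_one hL
  · obtain ⟨u, v, l, hL, rfl, rfl⟩ := exists_south_south hij hi hj (south_lt hj hjL)
    have hL' : L = (u ++ [S]) ++ (v ++ S :: l) := by simp [hL]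
    rw [pos_left hL', pos_left (u := u ++ S :: (v ++ [S])) (l := l) (by simp [hL])]
    exact (h.indentsApart.pair v l ⟨u, hL.symm⟩).1.ne

theorem mem_unimodalSet (h : Grow (entered c) 0 a p m L R) :
    L.reverse ++ E :: R ∈ unimodalSet m a (p + m + 1) := by
  refine ⟨⟨h.isPolygon, h.hasBox, ?_, h.length_eq⟩, h.leftIndented⟩
  obtain ⟨L', rfl⟩ := h.exists_left_eq_append_N
  simp

theorem mem_staircaseSet (h : Grow (entered false) 0 a p m L R) :
    L.reverse ++ E :: R ∈ staircaseSet m a (p + m + 1) := by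
  refine ⟨⟨h.mem_unimodalSet.1, L.length + 1, by simp, ?_⟩, h.leftIndented⟩
  rw [h.pos_top, h.neg_xdisp_right_of_not_turned rfl]

theorem eq_of_append_eq {c' : Bool} {L' R' : List Step} (h : Grow (entered c) 0 a p m L R)
    (h' : Grow (entered c') 0 a p m L' R') (e : L.reverse ++ E :: R = L'.reverse ++ E :: R') :
    L = L' ∧ R = R' := by
  have le := h'.le_of_pos_top (k := L.length + 1) (by simp [← e]) (by rw [← e, h.pos_top])
  have ge := h.le_of_pos_top (k := L'.length + 1) (by simp [e]) (by rw [e, h'.pos_top])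
  have := List.append_inj e (by rw [List.length_reverse, List.length_reverse]; omega)
  simpa using this

theorem notMem_staircaseSet (h : Grow (entered true) 0 a p m L R) :
    L.reverse ++ E :: R ∉ staircaseSet m a (p + m + 1) := by
  rintro ⟨⟨-, k, hk, corner⟩, -⟩
  have gap : -xdisp R = xdisp L + 0 + 1 := h.gap
  have height : -ydisp R = p + m + 1 := h.ydisp_right
  have width := h.count_E_right
  have east : 0 < R.count E := List.count_pos_iff.2 (h.shape.2.2.2 rfl)
  rcases exists_suffix_pos_eq h.closed.1 h.closed.2 hk with
    ⟨l, hl, -, hp⟩ | ⟨r, hr, -, hp⟩ <;> rw [hp, Prod.mk.injEq] at corner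
  · have := h.geometry.separated.left l hl
    omega
  · push_cast at corner
    obtain rfl := h.geometry.right_tip nofun nofun r hr (by omega)
    omega

end Grow

/-- Every south step of `w` is preceded by a north step. -/
def NorthFirst (w : List Step) : Prop := ∀ u v, w = u ++ S :: v → N ∈ u

/-- Between any two south steps of `w` there is a north step. -/
def NorthBetween (w : List Step) : Prop := ∀ t u v, w = t ++ S :: (u ++ S :: v) → N ∈ u

/-- The boundary walk of a polygon with all indents vertical, on the left, and at different
heights, split into the left edge `A` and the right boundary `B`. -/
structure IsSplit (a b : ℕ) (A B : List Step) : Prop where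
  selfAvoiding : ∀ u v z, A ++ B = u ++ (v ++ z) → v ≠ [] → z ≠ [] → xdisp v = 0 → ydisp v ≠ 0
  length_ge : 4 ≤ (A ++ B).length
  xdisp_eq_zero : xdisp A + xdisp B = 0
  ydisp_eq_zero : ydisp A + ydisp B = 0
  inside : ∀ u z, A ++ B = u ++ z → 0 ≤ xdisp u ∧ xdisp u ≤ a ∧ 0 ≤ ydisp u ∧ ydisp u ≤ b
  right : ∃ u z, A ++ B = u ++ z ∧ xdisp u = a
  count_E : (A ++ B).count E = a
  ydisp_left : ydisp A = b
  ydisp_neg : ∀ u z, B = u ++ z → u ≠ [] → ydisp u < 0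
  head : ∃ A', A = N :: A'
  N_notMem : N ∉ B
  depth_one : NorthBetween A
  heights : ∀ u v z, A = u ++ S :: (v ++ S :: z) → ydisp u ≠ ydisp (u ++ S :: v)

/-- The end of the walk `u` lies to the left of all vertices at its height of the walk `B`, which
ends at the origin. -/
def LeftOf (B u : List Step) : Prop :=
  ∀ u' z', B = u' ++ z' → ydisp u = -ydisp z' → xdisp u < -xdisp z'

section Walks

theorem xdisp_eq_count (w : List Step) : xdisp w = w.count E - w.count W := by
  induction w with
  | nil => simp
  | cons s w ih => cases s <;> simp [ih] <;> omega

@[simp] theorem xdisp_replicate_E (k : ℕ) : xdisp (List.replicate k E) = k := by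
  simp [xdisp_eq_count, List.count_replicate]

@[simp] theorem ydisp_replicate_E (k : ℕ) : ydisp (List.replicate k E) = 0 := by
  simp [ydisp, Step.vec]

theorem exists_suffix_ydisp_eq {w : List Step} (hN : N ∉ w) {h : ℤ} (h0 : 0 ≤ h)
    (hw : h ≤ -ydisp w) : ∃ u v, w = u ++ v ∧ -ydisp v = h := by
  induction w with
  | nil => exact ⟨[], [], rfl, by rw [ydisp_nil] at hw ⊢; omega⟩
  | cons c w ih =>
    simp only [List.mem_cons, not_or] at hN
    by_cases he : -ydisp (c :: w) = h
    · exact ⟨[], _, rfl, he⟩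
    · obtain ⟨u, v, rfl, hv⟩ := ih hN.2 (by cases c <;> simp_all; omega)
      exact ⟨c :: u, v, rfl, hv⟩

theorem exists_first_descent {w : List Step} {t : ℤ} (ht : 0 ≤ t) (h : t + ydisp w < 0) :
    ∃ u v, w = u ++ S :: v ∧ t + ydisp u = 0 := by
  induction w generalizing t with
  | nil => exact absurd ht (not_le_of_gt (by simpa using h))
  | cons c w ih =>
    by_cases h0 : c = S ∧ t = 0
    · exact ⟨[], w, by rw [h0.1, List.nil_append], by rw [h0.2]; rfl⟩
    · have shift : ∀ u, t + ydisp (c :: u) = t + ydisp [c] + ydisp u := fun u => by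
        rw [← List.singleton_append, ydisp_append, add_assoc]
      have ht' : 0 ≤ t + ydisp [c] := by
        cases c <;> simp only [true_and, ydisp_N, ydisp_E, ydisp_S, ydisp_W, ydisp_nil] at h0 ⊢ <;>
          omega
      obtain ⟨u, v, rfl, e⟩ := ih ht' (by rwa [← shift])
      exact ⟨c :: u, v, rfl, by rwa [shift]⟩

theorem NorthBetween.mono {v w : List Step} (h : NorthBetween w) (hv : v <:+: w) :
    NorthBetween v := by
  obtain ⟨s, t, rfl⟩ := hv
  exact fun t' u' v' e => h (s ++ t') u' (v' ++ t) (by simp [e])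

theorem NorthBetween.northFirst {v : List Step} (h : NorthBetween (S :: v)) : NorthFirst v :=
  fun u' v' e => h [] u' v' (by rw [e]; rfl)

theorem NorthFirst.of_cons {c : Step} {w : List Step} (h : NorthFirst (c :: w)) (hc : c ≠ N) :
    NorthFirst w := fun u v e => by simpa [hc.symm] using h (c :: u) v (by rw [e]; rfl)

theorem NorthBetween.neg_one_le_ydisp {w : List Step} (h : NorthBetween w) :
    -1 ≤ ydisp w ∧ (NorthFirst w → 0 ≤ ydisp w) := by
  induction w with
  | nil => simp
  | cons c w ih =>
    obtain ⟨low, nonneg⟩ := ih (h.mono (List.suffix_cons c w).isInfix)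
    cases c with
    | N => simp only [ydisp_N]; omega
    | S =>
      have := nonneg h.northFirst
      exact ⟨by rw [ydisp_S]; omega, fun first => by simpa using first [] w rfl⟩
    | E | W =>
      simp only [ydisp_E, ydisp_W]
      exact ⟨low, fun first => nonneg (first.of_cons nofun)⟩

theorem NorthBetween.exists_replicate_append_S {w : List Step} (h : NorthBetween w) (hW : W ∉ w)
    (hneg : ∃ u, u <+: w ∧ ydisp u < 0) : ∃ k r, w = List.replicate k E ++ S :: r := by
  induction w with
  | nil =>
    obtain ⟨u, hu, hy⟩ := hneg
    rw [List.prefix_nil.1 hu, ydisp_nil] at hy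
    exact absurd hy (lt_irrefl 0)
  | cons c w ih =>
    obtain ⟨_ | ⟨c', u⟩, hu, hy⟩ := hneg
    · exact absurd hy (lt_irrefl 0)
    obtain ⟨rfl, prefix_w⟩ := List.cons_prefix_cons.1 hu
    have hw := h.mono (List.suffix_cons _ w).isInfix
    cases c' with
    | S => exact ⟨0, _, rfl⟩
    | W => simp at hW
    | E =>
      obtain ⟨k, r, rfl⟩ := ih hw (fun hw => hW (List.mem_cons_of_mem _ hw))
        ⟨u, prefix_w, by simpa using hy⟩
      exact ⟨k + 1, r, by simp [List.replicate_succ]⟩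
    | N =>
      have := (hw.mono prefix_w.isInfix).neg_one_le_ydisp.1
      rw [ydisp_N] at hy
      omega

theorem NorthFirst.exists_replicate_append_N {w : List Step} (h : NorthFirst w) (hW : W ∉ w)
    (hy : 0 < ydisp w) : ∃ k r, w = List.replicate k E ++ N :: r := by
  induction w with
  | nil => simp at hy
  | cons c w ih =>
    cases c with
    | N => exact ⟨0, _, rfl⟩
    | W => simp at hW
    | S => simpa using h [] w rfl
    | E =>
      obtain ⟨k, r, rfl⟩ := ih (h.of_cons nofun) (fun hw => hW (List.mem_cons_of_mem _ hw))
        (by simpa using hy)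
      exact ⟨k + 1, r, by simp [List.replicate_succ]⟩

end Walks

theorem LeftOf.append_W {B u : List Step} (h : LeftOf B u) : LeftOf B (u ++ [W]) := by
  intro u' z' hB hy
  have := h u' z' hB (by simpa using hy)
  simp only [xdisp_append, xdisp_W, xdisp_nil]
  omega

namespace IsSplit

variable {a b : ℕ} {A B : List Step}

theorem ne_neg_of_split (H : IsSplit a b A B) {u z u' z' : List Step} (hA : A = u ++ z)
    (hz : z ≠ []) (hB : B = u' ++ z') (hne : u ≠ [] ∨ z' ≠ []) (hx : xdisp u = -xdisp z') :
    ydisp u ≠ -ydisp z' := by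
  intro hy
  have closed_x := H.xdisp_eq_zero
  have closed_y := H.ydisp_eq_zero
  rw [hA, hB] at closed_x closed_y
  simp only [xdisp_append, ydisp_append] at closed_x closed_y
  rcases eq_or_ne z' [] with rfl | hz'
  · exact H.selfAvoiding [] u (z ++ B) (by simp [hA]) (by simpa using hne) (by simp [hz])
      (by simpa using hx) (by simpa using hy)
  · refine H.selfAvoiding u (z ++ u') z' (by simp [hA, hB]) (by simp [hz]) hz' ?_ ?_
    · rw [xdisp_append]; omega
    · rw [ydisp_append]; omega

theorem not_backtrack (H : IsSplit a b A B) {u z : List Step} {s t : Step}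
    (h : A ++ B = u ++ ([s, t] ++ z)) (hx : xdisp [s, t] = 0) (hy : ydisp [s, t] = 0) : False := by
  rcases eq_or_ne z [] with rfl | hz
  · have closed_x := H.xdisp_eq_zero
    have closed_y := H.ydisp_eq_zero
    have long := H.length_ge
    rw [← xdisp_append, h] at closed_x
    rw [← ydisp_append, h] at closed_y
    rw [h] at long
    simp only [xdisp_append, ydisp_append, xdisp_nil, ydisp_nil] at closed_x closed_y
    refine H.selfAvoiding [] u [s, t] (by simpa using h) ?_ nofun (by omega) (by omega)
    rintro rfl
    simp at long
  · exact H.selfAvoiding u [s, t] z h nofun hz hx hy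

theorem inside_right (H : IsSplit a b A B) {u z : List Step} (hB : B = u ++ z) :
    0 ≤ -xdisp z ∧ -xdisp z ≤ a ∧ 0 ≤ -ydisp z ∧ -ydisp z ≤ b := by
  have closed_x := H.xdisp_eq_zero
  have closed_y := H.ydisp_eq_zero
  have := H.inside (A ++ u) z (by simp [hB])
  rw [hB] at closed_x closed_y
  simp only [xdisp_append, ydisp_append] at closed_x closed_y this
  omega

section LeftOf

variable {u z : List Step}

theorem leftOf_N (H : IsSplit a b A B) (hA : A = N :: z) (hz : z ≠ []) : LeftOf B [N] := by
  intro u' z' hB hy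
  have avoid : (0 : ℤ) = -xdisp z' → ydisp [N] ≠ -ydisp z' :=
    H.ne_neg_of_split (u := [N]) hA hz hB (.inl nofun)
  have := H.inside_right hB
  have : xdisp [N] = 0 := rfl
  omega

theorem leftOf_append_E (H : IsSplit a b A B) (hA : A = u ++ E :: z) (hz : z ≠ [])
    (h : LeftOf B u) : LeftOf B (u ++ [E]) := by
  intro u' z' hB hy
  have avoid := H.ne_neg_of_split (u := u ++ [E]) (by simpa using hA) hz hB (.inl (by simp))
  simp only [xdisp_append, ydisp_append, xdisp_E, ydisp_E, xdisp_nil, ydisp_nil] at avoid hy ⊢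
  have := h u' z' hB (by omega)
  omega

theorem leftOf_append_N (H : IsSplit a b A B) (hA : A = u ++ N :: z) (hz : z ≠ [])
    (h : LeftOf B u) : LeftOf B (u ++ [N]) := by
  intro u' z'
  induction z' generalizing u' with
  | nil =>
    intro _ hy
    have := H.inside u (N :: z ++ B) (by simp [hA])
    simp only [ydisp_append, ydisp_N, ydisp_nil] at hy
    omega
  | cons c z' ih =>
    intro hB hy
    have avoid := H.ne_neg_of_split (u := u ++ [N]) (by simpa using hA) hz hB (.inl (by simp))
    have same_row := ih (u' ++ [c]) (by simpa using hB)
    have row_below := h (u' ++ [c]) z' (by simpa using hB)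
    have hc : c ≠ N := fun hc => H.N_notMem (by simp [hB, hc])
    cases c with
    | N => exact absurd rfl hc
    | _ =>
      simp only [xdisp_append, ydisp_append, xdisp_N, ydisp_N, xdisp_E, ydisp_E, xdisp_S, ydisp_S,
        xdisp_W, ydisp_W, xdisp_nil, ydisp_nil] at hy avoid same_row row_below ⊢
      omega

theorem leftOf_append_S (H : IsSplit a b A B) (hA : A = u ++ S :: z) (hz : z ≠ [])
    (h : LeftOf B u) : LeftOf B (u ++ [S]) := by
  intro u'
  induction u' using List.reverseRecOn with
  | nil =>
    rintro z' rfl hy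
    have closed := H.ydisp_eq_zero
    have top := H.ydisp_left
    have := H.inside u (S :: z ++ B) (by simp [hA])
    simp only [ydisp_append, ydisp_S, ydisp_nil] at hy
    omega
  | append_singleton u' c ih =>
    intro z' hB hy
    have avoid := H.ne_neg_of_split (u := u ++ [S]) (by simpa using hA) hz hB (.inl (by simp))
    have same_row := ih (c :: z') (by simpa using hB)
    have row_above := h u' (c :: z') (by simpa using hB)
    have hc : c ≠ N := fun hc => H.N_notMem (by simp [hB, hc])
    cases c with
    | N => exact absurd rfl hc
    | _ =>
      simp only [xdisp_append, ydisp_append, xdisp_S, ydisp_S, xdisp_E, ydisp_E,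
        xdisp_W, ydisp_W, xdisp_nil, ydisp_nil] at hy avoid same_row row_above ⊢
      omega

theorem leftOf (H : IsSplit a b A B) (hu : u ≠ []) (hA : A = u ++ z) (hz : z ≠ []) :
    LeftOf B u := by
  induction u using List.reverseRecOn generalizing z with
  | nil => exact absurd rfl hu
  | append_singleton u s ih =>
    rcases eq_or_ne u [] with rfl | hu
    · obtain ⟨A', hA'⟩ := H.head
      obtain ⟨rfl, -⟩ := List.cons.inj (hA'.symm.trans hA)
      exact H.leftOf_N hA hz
    rw [List.append_assoc] at hA
    have left := ih hu hA (by simp)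
    cases s with
    | E => exact H.leftOf_append_E hA hz left
    | W => exact left.append_W
    | N => exact H.leftOf_append_N hA hz left
    | S => exact H.leftOf_append_S hA hz left

end LeftOf

theorem exists_right_before_W (H : IsSplit a b A B) {u z : List Step}
    (h : A ++ B = u ++ W :: z) : ∃ v t, u = v ++ t ∧ xdisp v = a ∧ E ∉ z := by
  obtain ⟨v, z', hv, hx⟩ := H.right
  have east := H.count_E
  have net := xdisp_eq_count v
  have no_west : W ∉ v := List.count_eq_zero.1 (by rw [hv, List.count_append] at east; omega)
  have no_east : E ∉ z' := List.count_eq_zero.1 (by rw [hv, List.count_append] at east; omega)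
  rw [hv] at h
  obtain ⟨t, rfl, ht⟩ | ⟨_ | ⟨c, t⟩, rfl, ht⟩ := List.append_eq_append_iff.1 h
  · exact ⟨v, t, rfl, hx, fun hE => no_east (by simp [ht, hE])⟩
  · rw [List.nil_append] at ht
    exact ⟨u, [], by simp, by simpa using hx, fun hE => no_east (by simp [← ht, hE])⟩
  · rw [List.cons_append, List.cons.injEq] at ht
    exact (no_west (by simp [← ht.1])).elim

theorem W_notMem_left (H : IsSplit a b A B) : W ∉ A := by
  intro hW
  obtain ⟨u, z, hA⟩ := List.append_of_mem hW
  obtain ⟨v, t, rfl, hx, -⟩ := H.exists_right_before_W (u := u) (z := z ++ B) (by simp [hA])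
  rcases eq_or_ne v [] with rfl | hv
  · have before := H.inside t (W :: z ++ B) (by simp [hA])
    have after := H.inside (t ++ [W]) (z ++ B) (by simp [hA])
    simp only [xdisp_append, xdisp_W, xdisp_nil] at hx after
    omega
  · have height := H.inside v (t ++ W :: z ++ B) (by simp [hA])
    have closed := H.ydisp_eq_zero
    have top := H.ydisp_left
    obtain ⟨u', z', hB, hy⟩ := exists_suffix_ydisp_eq H.N_notMem height.2.2.1 (by omega)
    have left := H.leftOf hv (z := t ++ W :: z) (by simp [hA]) (by simp) u' z' hB hy.symm
    have := H.inside_right hB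
    omega

theorem exists_indent (H : IsSplit a b A B) {U V : List Step} (hA : A = U ++ N :: V)
    (hneg : ∃ u, u <+: V ∧ ydisp u < 0) :
    ∃ k l V', V = List.replicate (k + 1) E ++ S :: (List.replicate (l + 1) E ++ N :: V') ∧
      ∀ u, u <+: V' → 0 ≤ ydisp u := by
  have hW : W ∉ V := fun h => H.W_notMem_left (by simp [hA, h])
  have north_V : NorthBetween V := H.depth_one.mono ⟨U ++ [N], [], by simp [hA]⟩
  obtain ⟨k, r, rfl⟩ := north_V.exists_replicate_append_S hW hneg
  have inside := H.inside (U ++ [N]) (List.replicate k E ++ S :: r ++ B) (by simp [hA])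
  have top := H.ydisp_left
  simp only [hA, ydisp_append, ydisp_N, ydisp_S, ydisp_replicate_E, ydisp_nil] at inside top
  obtain ⟨l, V', rfl⟩ :=
    (north_V.mono (List.suffix_append _ _).isInfix).northFirst.exists_replicate_append_N
      (fun h => hW (by simp [h])) (by omega)
  obtain _ | k := k
  · exact (H.not_backtrack (u := U) (s := N) (t := S)
      (z := List.replicate l E ++ N :: (V' ++ B)) (by simp [hA]) rfl rfl).elim
  obtain _ | l := l
  · exact (H.not_backtrack (u := U ++ N :: List.replicate (k + 1) E) (s := S) (t := N)
      (z := V' ++ B) (by simp [hA]) rfl rfl).elim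
  refine ⟨k, l, V', rfl, ?_⟩
  rintro u ⟨t, rfl⟩
  by_contra! below
  obtain ⟨y, z, rfl, hy⟩ := exists_first_descent (w := u) le_rfl (by simpa using below)
  refine H.heights (U ++ N :: List.replicate (k + 1) E) (List.replicate (l + 1) E ++ N :: y)
    (z ++ t) (by simp [hA]) ?_
  simp only [ydisp_append, ydisp_N, ydisp_S, ydisp_replicate_E] at hy ⊢
  omega

end IsSplit

theorem Grow.upper_of_entered {c : Bool} {d a p m : ℕ} {L R : List Step} (k : ℕ)
    (h : Grow (entered c) (d + (k + 1)) a p m L R) :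
    Grow (upper c) d a p m (List.replicate (k + 1) E ++ N :: L) R := by
  induction k generalizing d with
  | zero => exact .indent h
  | succ k ih => exact .eastUpper (ih (by rwa [show d + 1 + (k + 1) = d + (k + 1 + 1) by omega]))

theorem Grow.lower_of_upper {c : Bool} {d a p m : ℕ} {L R : List Step} (l : ℕ)
    (h : Grow (upper c) (d + (l + 1)) a p m L R) :
    Grow (lower c) d a p m (List.replicate (l + 1) E ++ S :: L) R := by
  induction l generalizing d with
  | zero => exact .descend h
  | succ l ih => exact .eastLower (ih (by rwa [show d + 1 + (l + 1) = d + (l + 1 + 1) by omega]))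

/-- A state of the construction of the left edge `A` and the right boundary `B`: the parts `L` and
`R` have been built, and the parts `A'` and `B'`, of which `A'` stays above its start, remain. -/
structure Reached (A B : List Step) (s : Stage) (d a p m : ℕ) (A' B' L R : List Step) :
    Prop where
  grow : Grow s d a p m L R
  left : A = L.reverse ++ A'
  right : B = B' ++ R
  nonneg : ∀ u, u <+: A' → 0 ≤ ydisp u

/-- The stages in which the two walks are extended by whole rows. When the right boundary is about
to turn, with `B'` remaining, the stage is no longer `widening`. -/
def Stage.IsRegular (B' : List Step) : Stage → Prop
  | widening => B'.getLast? ≠ some E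
  | shrinking | entered _ => True
  | _ => False

/-- The construction of `A` and `B` can be carried on until fewer than `n` steps remain. -/
def Progress (A B : List Step) (n : ℕ) : Prop :=
  ∃ s d a p m A' B' L R, Reached A B s d a p m A' B' L R ∧ Stage.IsRegular B' s ∧
    A'.length + B'.length < n

/-- The walks `A` and `B` together form the boundary of a complete construction. -/
def Complete (A B : List Step) : Prop :=
  ∃ c a p m L R, Grow (entered c) 0 a p m L R ∧ A ++ B = L.reverse ++ E :: R

namespace IsSplit

variable {a b : ℕ} {A B : List Step}

section Obstructions

variable {A' B' L R : List Step}

theorem right_eq_nil (H : IsSplit a b A B) (hB : B = B' ++ R) (h : 0 ≤ ydisp B') : B' = [] := by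
  by_contra hne
  exact (H.ydisp_neg B' R hB hne).not_ge h

theorem exists_right_step (H : IsSplit a b A B) (hA : A = L.reverse ++ A') (hB : B = B' ++ R)
    (hy : -ydisp R < ydisp L) : ∃ B₁ c, B' = B₁ ++ [c] ∧ c ≠ N := by
  obtain rfl | ⟨B₁, c, rfl⟩ := List.eq_nil_or_concat B'
  · have closed := H.ydisp_eq_zero
    have top := H.ydisp_left
    have := H.inside L.reverse (A' ++ B) (by simp [hA])
    rw [hB, List.nil_append] at closed
    rw [ydisp_reverse] at this
    omega
  · exact ⟨B₁, c, by simp, fun hc => H.N_notMem (by simp [hB, hc])⟩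

theorem xdisp_ne_of_right_S (H : IsSplit a b A B) (hA : A = (N :: L).reverse ++ A')
    (hB : B = B' ++ S :: R) (hy : -ydisp R = ydisp L) : -xdisp R ≠ xdisp L := by
  intro hx
  rcases eq_or_ne A' [] with rfl | hA'
  · have closed := H.ydisp_eq_zero
    simp only [hA, hB, ydisp_append, ydisp_reverse, ydisp_N, ydisp_S, ydisp_nil] at closed
    obtain rfl := H.right_eq_nil hB (by omega)
    exact H.not_backtrack (u := L.reverse) (s := N) (t := S) (z := R) (by simp [hA, hB]) rfl rfl
  · refine H.ne_neg_of_split hA hA' hB (.inr nofun) ?_ ?_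
    · simp [hx]
    · simp only [ydisp_reverse, ydisp_N, ydisp_S]; omega

theorem xdisp_ne_of_right_E (H : IsSplit a b A B) (hA : A = (N :: L).reverse ++ A')
    (hB : B = B' ++ E :: R) (hy : -ydisp R = ydisp L) : -xdisp R ≠ xdisp L + 1 := by
  intro hx
  refine H.ne_neg_of_split (u := L.reverse) (z := N :: A') (by simp [hA]) nofun hB (.inr nofun)
    ?_ ?_
  · rw [xdisp_reverse, xdisp_E]; omega
  · rw [ydisp_reverse, ydisp_E, hy]

end Obstructions

variable {d a' p m : ℕ} {A' B' L R : List Step}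

theorem progress_widening (H : IsSplit a b A B) (r : Reached A B widening d a' p m A' B' L R)
    (hs : B'.getLast? ≠ some E) : Progress A B (A'.length + B'.length) := by
  obtain ⟨grow, hA, hB, nonneg⟩ := r
  have gap : -xdisp R = xdisp L + d + 0 := grow.gap
  have left : ydisp L = p + m + 1 + 0 := grow.ydisp_left
  have right : -ydisp R = p + m + 0 := grow.ydisp_right
  obtain ⟨B₁, c, rfl, hc⟩ := H.exists_right_step hA hB (by omega)
  rw [List.append_assoc, List.singleton_append] at hB
  have shorter : A'.length + B₁.length < A'.length + (B₁ ++ [c]).length := by simp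
  cases c with
  | N => exact absurd rfl hc
  | E => simp at hs
  | W =>
    refine ⟨_, _, _, _, _, _, _, _, _, ⟨grow.widen, hA, hB, nonneg⟩, fun hl => ?_, shorter⟩
    obtain ⟨B₂, rfl⟩ := List.getLast?_eq_some_iff.1 hl
    exact H.not_backtrack (u := A ++ B₂) (s := E) (t := W) (z := R) (by simp [hB]) rfl rfl
  | S =>
    obtain _ | d := d
    · obtain ⟨L₁, rfl⟩ := List.head?_eq_some_iff.1 grow.shape.1
      rw [xdisp_N] at gap
      rw [ydisp_N] at left
      exact absurd (by omega) (H.xdisp_ne_of_right_S hA hB (by omega))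
    · exact ⟨_, _, _, _, _, _, _, _, _, ⟨grow.enterWide, hA, hB, nonneg⟩, trivial, shorter⟩

theorem progress_shrinking (H : IsSplit a b A B)
    (r : Reached A B shrinking d a' p m A' B' L R) : Progress A B (A'.length + B'.length) := by
  obtain ⟨grow, hA, hB, nonneg⟩ := r
  have gap : -xdisp R = xdisp L + d + 1 := grow.gap
  have left : ydisp L = p + m + 1 + 0 := grow.ydisp_left
  have right : -ydisp R = p + m + 0 := grow.ydisp_right
  obtain ⟨B₁, c, rfl, hc⟩ := H.exists_right_step hA hB (by omega)
  rw [List.append_assoc, List.singleton_append] at hB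
  have shorter : A'.length + B₁.length < A'.length + (B₁ ++ [c]).length := by simp
  cases c with
  | N => exact absurd rfl hc
  | W =>
    obtain ⟨-, -, -, -, east⟩ := H.exists_right_before_W (u := A ++ B₁) (z := R) (by simp [hB])
    exact absurd grow.shape.2 east
  | E =>
    obtain _ | d := d
    · obtain ⟨L₁, rfl⟩ := List.head?_eq_some_iff.1 grow.shape.1
      rw [xdisp_N] at gap
      rw [ydisp_N] at left
      exact absurd (by omega) (H.xdisp_ne_of_right_E hA hB (by omega))
    · exact ⟨_, _, _, _, _, _, _, _, _, ⟨grow.shrink, hA, hB, nonneg⟩, trivial, shorter⟩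
  | S => exact ⟨_, _, _, _, _, _, _, _, _, ⟨grow.enterShrink, hA, hB, nonneg⟩, trivial, shorter⟩

theorem progress_raised (H : IsSplit a b A B) {c : Bool} {n : ℕ}
    (r : Reached A B (raised c) d a' p m A' B' L R) (hn : A'.length + B'.length < n) :
    Progress A B n := by
  obtain ⟨grow, hA, hB, nonneg⟩ := r
  cases c with
  | true => exact ⟨_, _, _, _, _, _, _, _, _, ⟨grow.keep, hA, hB, nonneg⟩, trivial, hn⟩
  | false =>
    by_cases hl : B'.getLast? = some E
    · obtain ⟨B₁, rfl⟩ := List.getLast?_eq_some_iff.1 hl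
      rw [List.append_assoc, List.singleton_append] at hB
      rw [List.length_append, List.length_singleton] at hn
      obtain _ | d := d
      · have gap : -xdisp R = xdisp L + 0 + 1 := grow.gap
        have left : ydisp L = p + m + 1 + 0 := grow.ydisp_left
        have right : -ydisp R = p + m + 0 := grow.ydisp_right
        obtain ⟨L₁, rfl⟩ := List.head?_eq_some_iff.1 grow.shape.1
        rw [xdisp_N] at gap
        rw [ydisp_N] at left
        exact absurd (by omega) (H.xdisp_ne_of_right_E hA hB (by omega))
      · exact ⟨_, _, _, _, _, _, _, _, _, ⟨grow.turn, hA, hB, nonneg⟩, trivial, by omega⟩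
    · exact ⟨_, _, _, _, _, _, _, _, _, ⟨grow.settle, hA, hB, nonneg⟩, hl, hn⟩

theorem progress_entered_N (H : IsSplit a b A B) {c : Bool}
    (r : Reached A B (entered c) d a' p m (N :: A') B' L R) :
    Progress A B ((N :: A').length + B'.length) := by
  obtain ⟨grow, hA, hB, nonneg⟩ := r
  by_cases returns : ∃ u, u <+: A' ∧ ydisp u < 0
  · have gap : -xdisp R = xdisp L + d + 1 := grow.gap
    have left : ydisp L = p + m + 1 + 0 := grow.ydisp_left
    have right : -ydisp R = p + m + 1 := grow.ydisp_right
    obtain ⟨k, l, A₁, rfl, nonneg₁⟩ := H.exists_indent hA returns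
    have room := H.leftOf
      (u := L.reverse ++ N :: (List.replicate (k + 1) E ++ S :: List.replicate (l + 1) E))
      (z := N :: A₁) (by simp) (by simp [hA]) nofun B' R hB (by simp; omega)
    simp only [xdisp_append, xdisp_reverse, xdisp_N, xdisp_S, xdisp_replicate_E] at room
    obtain ⟨e, rfl⟩ : ∃ e, d = e + (l + 1) + (k + 1) :=
      ⟨d - (l + 1) - (k + 1), by push_cast at room; omega⟩
    exact H.progress_raised ⟨.raiseIndent (.lower_of_upper l (.upper_of_entered k grow)),
      by simp [hA], hB, nonneg₁⟩ (by simp; omega)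
  · push Not at returns
    exact H.progress_raised ⟨grow.raise, by simp [hA], hB, returns⟩ (by simp)

theorem progress_or_complete_entered_E (H : IsSplit a b A B) {c : Bool}
    (r : Reached A B (entered c) d a' p m (E :: A') B' L R) :
    Progress A B ((E :: A').length + B'.length) ∨ Complete A B := by
  obtain ⟨grow, hA, hB, nonneg⟩ := r
  have gap : -xdisp R = xdisp L + d + 1 := grow.gap
  have left : ydisp L = p + m + 1 + 0 := grow.ydisp_left
  have right : -ydisp R = p + m + 1 := grow.ydisp_right
  have hA' : A = (E :: L).reverse ++ A' := by simp [hA]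
  obtain _ | d := d
  · have meet : A' = [] := by
      by_contra hne
      refine H.ne_neg_of_split hA' hne hB (.inl (by simp)) ?_ ?_
      · rw [xdisp_reverse, xdisp_E]; omega
      · rw [ydisp_reverse, ydisp_E]; omega
    have closed := H.ydisp_eq_zero
    simp only [hA', meet, hB, ydisp_append, ydisp_reverse, ydisp_E, ydisp_nil] at closed
    have hB' := H.right_eq_nil hB (by omega)
    exact .inr ⟨_, _, _, _, L, R, grow, by simp [hA, hB, meet, hB']⟩
  · refine .inl ⟨_, _, _, _, _, _, _, _, _, ⟨grow.east, hA', hB, fun u hu => ?_⟩, trivial,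
      by simp⟩
    simpa using nonneg (E :: u) (by simpa using hu)

theorem progress_or_complete_entered (H : IsSplit a b A B) {c : Bool}
    (r : Reached A B (entered c) d a' p m A' B' L R) :
    Progress A B (A'.length + B'.length) ∨ Complete A B := by
  rcases A' with _ | ⟨_ | _ | _ | _, A'⟩
  · have gap : -xdisp R = xdisp L + d + 1 := r.grow.gap
    have left : ydisp L = p + m + 1 + 0 := r.grow.ydisp_left
    have right : -ydisp R = p + m + 1 := r.grow.ydisp_right
    have closed_x := H.xdisp_eq_zero
    have closed_y := H.ydisp_eq_zero
    simp only [r.left, r.right, xdisp_append, ydisp_append, xdisp_reverse, ydisp_reverse,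
      xdisp_nil, ydisp_nil] at closed_x closed_y
    rw [H.right_eq_nil r.right (by omega), xdisp_nil] at closed_x
    omega
  · exact .inl (H.progress_entered_N r)
  · exact H.progress_or_complete_entered_E r
  · simpa using r.nonneg [S] (by simp)
  · exact absurd (by simp [r.left]) H.W_notMem_left

theorem complete_of_progress (H : IsSplit a b A B) {n : ℕ} (h : Progress A B n) :
    Complete A B := by
  induction n using Nat.strong_induction_on with
  | _ n ih =>
  obtain ⟨s, d, a', p, m, A', B', L, R, r, hs, hn⟩ := h
  cases s with
  | widening => exact ih _ hn (H.progress_widening r hs)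
  | shrinking => exact ih _ hn (H.progress_shrinking r)
  | entered c => exact (H.progress_or_complete_entered r).elim (ih _ hn) id
  | upper | lower | raised => exact hs.elim

theorem nonneg_of_prefix_tail (H : IsSplit a b A B) (hA : A = N :: A') {u : List Step}
    (hu : u <+: A') : 0 ≤ ydisp u := by
  obtain ⟨t, rfl⟩ := hu
  by_contra! below
  have inside := H.inside (N :: u) (t ++ B) (by simp [hA])
  have first := H.inside [N] (u ++ t ++ B) (by simp [hA])
  have top := H.ydisp_left
  rw [ydisp_N] at inside first
  have ht : t ≠ [] := by
    rintro rfl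
    rw [hA, List.append_nil, ydisp_N] at top
    rw [ydisp_nil] at first
    omega
  have := H.leftOf (u := N :: u) nofun (by simp [hA]) ht B [] (by simp)
    (by rw [ydisp_N, ydisp_nil]; omega)
  rw [xdisp_nil] at this
  omega

theorem complete (H : IsSplit a b A B) : Complete A B := by
  obtain ⟨A', hA⟩ := H.head
  refine H.complete_of_progress ⟨widening, _, _, _, _, A', B, [N], [],
    ⟨.base, by simp [hA], by simp, fun u => H.nonneg_of_prefix_tail hA⟩, fun hl => ?_,
    Nat.lt_succ_self _⟩
  obtain ⟨B', hB⟩ := List.getLast?_eq_some_iff.1 hl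
  simpa using H.inside_right hB

end IsSplit

section Split

variable {m a b : ℕ} {A B w : List Step}

theorem exists_append_last_height {b : ℤ} (h : ∃ k ≤ w.length, (pos w k).2 = b) :
    ∃ A B, w = A ++ B ∧ ydisp A = b ∧ ∀ u z, B = u ++ z → u ≠ [] → ydisp u ≠ 0 := by
  classical
  obtain ⟨k, hk, hb⟩ := h
  set T := Nat.findGreatest (fun k => (pos w k).2 = b) w.length with hT
  have at_T : (pos w T).2 = b := Nat.findGreatest_spec (P := fun k => (pos w k).2 = b) hk hb
  obtain ⟨A, B, rfl, length_A⟩ : ∃ A B, w = A ++ B ∧ A.length = T :=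
    ⟨_, _, (List.take_append_drop T w).symm, by simpa using Nat.findGreatest_le _⟩
  rw [← length_A, pos_append_length] at at_T
  refine ⟨A, B, rfl, at_T, ?_⟩
  rintro u z rfl hu hy
  have longer : T < (A ++ u).length := by
    rw [List.length_append]
    have := List.length_pos_iff.2 hu
    omega
  refine Nat.findGreatest_is_greatest longer (by simp) ?_
  rw [← List.append_assoc, pos_append_length, ydisp_append, hy, add_zero, at_T]

theorem HasBox.inside_of_append (h : HasBox a b w) {u z : List Step} (e : w = u ++ z) :
    0 ≤ xdisp u ∧ xdisp u ≤ a ∧ 0 ≤ ydisp u ∧ ydisp u ≤ b := by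
  have := h.inside u.length (by simp [e])
  rwa [e, pos_append_length] at this

theorem HasBox.exists_append_xdisp_eq (h : HasBox a b w) :
    ∃ u z, w = u ++ z ∧ xdisp u = a := by
  obtain ⟨k, -, hr⟩ := h.right
  refine ⟨w.take k, w.drop k, (List.take_append_drop k w).symm, ?_⟩
  rwa [pos_eq] at hr

theorem HasBox.eq_of_hasBox {a' b' : ℕ} (h : HasBox a b w) (h' : HasBox a' b' w) :
    a = a' ∧ b = b' := by
  obtain ⟨k, hk, e⟩ := h.right
  obtain ⟨k', hk', e'⟩ := h'.right
  obtain ⟨j, hj, f⟩ := h.top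
  obtain ⟨j', hj', f'⟩ := h'.top
  have := h.inside k' hk'
  have := h'.inside k hk
  have := h.inside j' hj'
  have := h'.inside j hj
  omega

theorem IsPolygon.disp_eq_zero (h : IsPolygon w) : xdisp w = 0 ∧ ydisp w = 0 := by
  have closed := h.closed
  rwa [pos_eq, List.take_length, Prod.mk_eq_zero] at closed

theorem IsPolygon.ydisp_ne_zero (h : IsPolygon w) {u v z : List Step} (e : w = u ++ (v ++ z))
    (hv : v ≠ []) (hz : z ≠ []) (hx : xdisp v = 0) : ydisp v ≠ 0 := by
  intro hy
  have := List.length_pos_iff.2 hv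
  have := List.length_pos_iff.2 hz
  refine h.simple u.length (u ++ v).length (by simpa) (by simp [e]; omega) ?_
  rw [e, pos_append_length, ← List.append_assoc, pos_append_length, xdisp_append, ydisp_append,
    hx, hy, add_zero, add_zero]

theorem onLeftEdge_of_lt (hA : ydisp A = b) {k : ℕ} (hk : k < A.length) :
    OnLeftEdge b (A ++ B) k :=
  ⟨A.length, hk, by simp, by rw [pos_append_length, hA]⟩

theorem getElem?_append_cons_length {α : Type*} (u : List α) (c : α) (v : List α) :
    (u ++ c :: v)[u.length]? = some c := by
  simp

theorem LeftIndented.N_notMem (h : LeftIndented a b (A ++ B)) (hA : ydisp A = b)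
    (above : ∀ u z, B = u ++ z → u ≠ [] → ydisp u ≠ 0) : N ∉ B := by
  intro hN
  obtain ⟨i, hi⟩ := List.mem_iff_getElem?.1 hN
  obtain ⟨j, hij, -, top⟩ := h.only_left (A.length + i) (by
    rw [List.getElem?_append_right (Nat.le_add_right ..), Nat.add_sub_cancel_left, hi])
  obtain ⟨n, rfl⟩ := Nat.exists_eq_add_of_le (show A.length ≤ j by omega)
  rw [pos_eq, List.take_length_add_append, ydisp_append, hA] at top
  refine above (B.take n) (B.drop n) (List.take_append_drop n B).symm ?_ (by simpa using top)
  intro nil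
  rw [List.take_eq_nil_iff] at nil
  rcases nil with rfl | rfl
  · omega
  · exact List.not_mem_nil hN

theorem LeftIndented.northBetween (h : LeftIndented a b (A ++ B)) (hA : ydisp A = b) :
    NorthBetween A := by
  rintro u v z rfl
  have hw : u ++ S :: (v ++ S :: z) ++ B = (u ++ S :: v) ++ S :: (z ++ B) := by simp
  obtain ⟨k, hk, hk', north⟩ := h.depth_one u.length (u ++ S :: v).length (by simp) (by simp)
    (by rw [hw, getElem?_append_cons_length]) (onLeftEdge_of_lt hA (by simp))
  rw [show u ++ S :: (v ++ S :: z) ++ B = (u ++ [S]) ++ (v ++ (S :: z ++ B)) by simp,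
    List.getElem?_append_right (by simpa using hk),
    List.getElem?_append_left (by
      simp only [List.length_append, List.length_cons, List.length_nil] at hk hk' ⊢
      omega)] at north
  exact List.mem_of_getElem? north

theorem LeftIndented.ydisp_ne (h : LeftIndented a b (A ++ B)) (hA : ydisp A = b)
    {u v z : List Step} (e : A = u ++ S :: (v ++ S :: z)) : ydisp u ≠ ydisp (u ++ S :: v) := by
  subst e
  have hw : u ++ S :: (v ++ S :: z) ++ B = (u ++ S :: v) ++ S :: (z ++ B) := by simp
  have hw' : u ++ S :: (v ++ S :: z) ++ B = u ++ S :: (v ++ S :: z ++ B) := by simp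
  have := h.heights u.length (u ++ S :: v).length (by simp) (by simp)
    (by rw [hw, getElem?_append_cons_length]) (onLeftEdge_of_lt hA (by simp))
  rwa [hw, pos_append_length, ← hw, hw', pos_append_length] at this

theorem IsUnimodal.exists_eq_cons_N (h : IsUnimodal m a b (A ++ B)) (hA : ydisp A = b) :
    ∃ A', A = N :: A' := by
  have north := h.clockwise
  cases A with
  | nil =>
    obtain ⟨w', hw⟩ := List.head?_eq_some_iff.1 north
    have below := h.box.inside_of_append (u := [N]) hw
    rw [ydisp_nil] at hA
    simp only [ydisp_N, ydisp_nil] at below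
    omega
  | cons s A' => exact ⟨A', by rw [Option.some_inj.1 north]⟩

theorem exists_isSplit (h : w ∈ unimodalSet m a b) : ∃ A B, w = A ++ B ∧ IsSplit a b A B := by
  obtain ⟨hu, hi⟩ := h
  obtain ⟨A, B, rfl, hA, last⟩ := exists_append_last_height hu.box.top
  have closed := hu.polygon.disp_eq_zero
  rw [xdisp_append, ydisp_append] at closed
  refine ⟨A, B, rfl, {
    selfAvoiding := fun u v z => hu.polygon.ydisp_ne_zero
    length_ge := hu.polygon.length_ge
    xdisp_eq_zero := closed.1
    ydisp_eq_zero := closed.2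
    inside := fun u z => hu.box.inside_of_append
    right := hu.box.exists_append_xdisp_eq
    count_E := hi.no_horizontal
    ydisp_left := hA
    ydisp_neg := fun u z e hne => ?_
    head := hu.exists_eq_cons_N hA
    N_notMem := hi.N_notMem hA last
    depth_one := hi.northBetween hA
    heights := fun u v z => hi.ydisp_ne hA }⟩
  have below := hu.box.inside_of_append (u := A ++ u) (z := z) (by rw [e, List.append_assoc])
  have := last u z e hne
  rw [ydisp_append] at below
  omega

end Split

section Counting

variable {m a b : ℕ} {w : List Step}

theorem mem_unimodalSet_iff : w ∈ unimodalSet m a b ↔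
    ∃ c p L R, b = p + m + 1 ∧ Grow (entered c) 0 a p m L R ∧ w = L.reverse ++ E :: R := by
  constructor
  · intro h
    obtain ⟨A, B, rfl, H⟩ := exists_isSplit h
    obtain ⟨c, a', p, m', L, R, grown, e⟩ := H.complete
    have h' := grown.mem_unimodalSet
    rw [← e] at h'
    obtain ⟨rfl, rfl⟩ := h.1.box.eq_of_hasBox h'.1.box
    have := h.1.perimeter
    have := h'.1.perimeter
    obtain rfl : m = m' := by omega
    exact ⟨c, p, L, R, rfl, grown, e⟩
  · rintro ⟨c, p, L, R, rfl, grown, rfl⟩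
    exact grown.mem_unimodalSet

theorem mem_staircaseSet_iff : w ∈ staircaseSet m a b ↔
    ∃ p L R, b = p + m + 1 ∧ Grow (entered false) 0 a p m L R ∧ w = L.reverse ++ E :: R := by
  constructor
  · intro h
    obtain ⟨c, p, L, R, rfl, grown, rfl⟩ := mem_unimodalSet_iff.1 ⟨h.1.toIsUnimodal, h.2⟩
    cases c with
    | false => exact ⟨p, L, R, rfl, grown, rfl⟩
    | true => exact absurd h grown.notMem_staircaseSet
  · rintro ⟨p, L, R, rfl, grown, rfl⟩
    exact grown.mem_staircaseSet

theorem staircaseSet_eq_image (m a p : ℕ) : staircaseSet m a (p + m + 1) =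
    (fun q => q.1.reverse ++ E :: q.2) '' growSet (entered false) 0 a p m := by
  ext w
  rw [mem_staircaseSet_iff]
  constructor
  · rintro ⟨p', L, R, hp, grown, rfl⟩
    obtain rfl : p = p' := by omega
    exact ⟨(L, R), grown, rfl⟩
  · rintro ⟨⟨L, R⟩, grown, rfl⟩
    exact ⟨p, L, R, rfl, grown, rfl⟩

theorem unimodalSet_eq_image (m a p : ℕ) : unimodalSet m a (p + m + 1) =
    (fun q => q.1.reverse ++ E :: q.2) ''
      (growSet (entered false) 0 a p m ∪ growSet (entered true) 0 a p m) := by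
  ext w
  rw [mem_unimodalSet_iff]
  constructor
  · rintro ⟨c, p', L, R, hp, grown, rfl⟩
    obtain rfl : p = p' := by omega
    refine ⟨(L, R), ?_, rfl⟩
    cases c
    exacts [.inl grown, .inr grown]
  · rintro ⟨⟨L, R⟩, grown | grown, rfl⟩ <;> exact ⟨_, p, L, R, rfl, grown, rfl⟩

theorem ncard_staircaseSet (m a p : ℕ) :
    (staircaseSet m a (p + m + 1)).ncard = (growSet (entered false) 0 a p m).ncard := by
  rw [staircaseSet_eq_image]
  exact Set.InjOn.ncard_image fun q hq q' hq' e => Prod.ext_iff.2 (Grow.eq_of_append_eq hq hq' e)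

theorem disjoint_growSet_entered (d a p m : ℕ) :
    Disjoint (growSet (entered false) d a p m) (growSet (entered true) d a p m) :=
  Set.disjoint_left.2 fun _ h h' => by simpa using (Grow.shape h).2.2.1 ((Grow.shape h').2.2.2 rfl)

theorem ncard_unimodalSet (m a p : ℕ) : (unimodalSet m a (p + m + 1)).ncard =
    (growSet (entered false) 0 a p m).ncard + (growSet (entered true) 0 a p m).ncard := by
  rw [unimodalSet_eq_image, Set.InjOn.ncard_image, Set.ncard_union_eq
    (disjoint_growSet_entered ..) (growSet_finite ..) (growSet_finite ..)]
  rintro q (hq | hq) q' (hq' | hq') e <;> exact Prod.ext_iff.2 (Grow.eq_of_append_eq hq hq' e)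

end Counting

theorem eq_y_pow_mul {k : ℕ} {F f : Series} (low : ∀ e, e 1 < k → MvPowerSeries.coeff e F = 0)
    (shift : ∀ e, MvPowerSeries.coeff (e + Finsupp.single 1 k) F = MvPowerSeries.coeff e f) :
    F = y ^ k * f := by
  classical
  ext e
  rw [y, MvPowerSeries.X_pow_eq, MvPowerSeries.coeff_monomial_mul, one_mul, ← shift]
  split_ifs with h
  · rw [tsub_add_cancel_of_le h]
  · exact low e (by simpa [Finsupp.single_le_iff] using h)

theorem coeff_staircaseGF (m : ℕ) (e : Fin 2 →₀ ℕ) :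
    MvPowerSeries.coeff e (staircaseGF m) = (staircaseSet m (e 0) (e 1)).ncard := rfl

theorem coeff_unimodalGF (m : ℕ) (e : Fin 2 →₀ ℕ) :
    MvPowerSeries.coeff e (unimodalGF m) = (unimodalSet m (e 0) (e 1)).ncard := rfl

theorem unimodalSet_eq_empty {m a b : ℕ} (h : b < m + 1) : unimodalSet m a b = ∅ := by
  refine Set.eq_empty_of_forall_notMem fun w hw => ?_
  obtain ⟨c, p, L, R, rfl, -⟩ := mem_unimodalSet_iff.1 hw
  omega

theorem staircaseSet_eq_empty {m a b : ℕ} (h : b < m + 1) : staircaseSet m a b = ∅ := by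
  refine Set.eq_empty_of_forall_notMem fun w hw => ?_
  obtain ⟨p, L, R, rfl, -⟩ := mem_staircaseSet_iff.1 hw
  omega

theorem staircaseGF_eq (m : ℕ) :
    staircaseGF m = y ^ (m + 1) * PowerSeries.coeff m (growSeries (entered false) 0) := by
  refine eq_y_pow_mul (fun e he => ?_) fun e => ?_
  · rw [coeff_staircaseGF, staircaseSet_eq_empty he, Set.ncard_empty, Nat.cast_zero]
  · rw [coeff_staircaseGF, growSeries, coeff_genSeries, ← ncard_staircaseSet]
    simp [add_assoc]

theorem unimodalGF_eq (m : ℕ) : unimodalGF m = y ^ (m + 1) *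
    PowerSeries.coeff m (growSeries (entered false) 0 + growSeries (entered true) 0) := by
  refine eq_y_pow_mul (fun e he => ?_) fun e => ?_
  · rw [coeff_unimodalGF, unimodalSet_eq_empty he, Set.ncard_empty, Nat.cast_zero]
  · rw [map_add, map_add, coeff_unimodalGF, growSeries, growSeries, coeff_genSeries,
      coeff_genSeries, ← Nat.cast_add, ← ncard_unimodalSet]
    simp [add_assoc]

end MConvex

theorem mainTheorem8 (m : ℕ) (hm : 1 ≤ m) :
    MConvex.staircaseGF m =
        MvPowerSeries.C (1 / (Nat.factorial m : ℚ)) * MConvex.y ^ (m + 1) *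
          MConvex.dy^[m - 1] (MConvex.I ^ m * MConvex.dy (MConvex.divY MConvex.SP)) ∧
      MConvex.unimodalGF m =
        MvPowerSeries.C (1 / (Nat.factorial m : ℚ)) * MConvex.y ^ (m + 1) *
          MConvex.dy^[m - 1] (MConvex.I ^ m * MConvex.dy (MConvex.divY MConvex.UP)) := by
  obtain ⟨k, rfl⟩ := Nat.exists_eq_add_of_le' hm
  rw [MConvex.staircaseGF_eq, MConvex.unimodalGF_eq, MConvex.coeff_growSeries_staircase,
    MConvex.coeff_growSeries_unimodal, Nat.add_sub_cancel]
  constructor <;> ring
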